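/- Let $N=N(X)$ be a network: an arbitrary connected simple graph $X$ (not necessarily locally finite) with a map $c:EX\to\{1,2,\dots\}$. For $A\subseteq VX$ write $A^*=VX\setminus A$ and let $\delta A$ be the set of edges with one vertex in $A$ and one in $A^*$. Call $A$ a cut if $\delta A$ is finite, and put $c(A)=\sum_{e\in\delta A}c(e)$. A ray is an infinite sequence of distinct vertices, consecutive ones being adjacent. A cut $A$ separates two rays if one of them is eventually in $A$ and the other is eventually in $A^*$. Two rays are equivalent if no cut separates them, and $\Omega X$ is the set of equivalence classes (the edge ends of $X$). A vertex lies in $A$ if it belongs to $A$; an end lies in $A$ if the rays representing it are eventually in $A$; and $A$ separates $x,y\in VX\cup\Omega X$ if one of them lies in $A$ and the other in $A^*$. Let $\mathcal B_n$ be the Boolean ring (with unit $VX$) of subsets of $VX$ generated by the cuts $A$ with $c(A)\le n$. A cut $A$ is thin if it is not in the Boolean ring generated by the cuts of capacity strictly less than $c(A)$. Two sets $A,B$ are nested if one of $A\cap B$, $A^*\cap B$, $A\cap B^*$, $A^*\cap B^*$ is empty. Theorem. To every network $N=N(X)$ and every integer $n\ge 0$ one can assign a set $\mathcal E_n$ of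 thin cuts of capacity at most $n$, a network $N(T_n)$ based on a tree $T_n$, and a map $\nu:VX\cup\Omega X\to VT_n\cup\Omega T_n$ such that: (1) $\mathcal E_n$ is closed under complementation, any two of its elements are nested, it generates $\mathcal B_n$, and $\mathcal E_m\subseteq\mathcal E_n$ for $m\le n$. (2) The oriented edges of $T_n$ correspond bijectively to the elements of $\mathcal E_n$, reversal of an edge corresponding to complementation. The capacity in $N(T_n)$ of the edge corresponding to $A$ is $c(A)$. For $x\in VX\cup\Omega X$, $\nu x$ lies on the side of the initial vertex of the oriented edge corresponding to $A$ if $x$ lies in $A$, and on the other side if $x$ lies in $A^*$. (3) $\nu(VX)\subseteq VT_n$, and for all $x,y\in VX\cup\Omega X$, $\nu x=\nu y$ if and only if $x$ and $y$ are not separated by a cut $A$ with $c(A)\le n$. (4) The construction is canonical: every isomorphism $\varphi:N(X)\to N(X')$ of networks carries the set $\mathcal E_n$ of $N(X)$ onto that of $N(X')$ and induces an isomorphism of the tree networks which is compatible with $\nu$ and with the correspondence between oriented edges and cuts, and which depends functorially on $\varphi$ (identities induce identities, composites induce composites). In particular $\mathcal E_n$ is invariant under $\mathrm{Aut}(N(X))$,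 which acts on $N(T_n)$ by automorphisms, and $\nu$ is equivariant. -/

import Mathlib

open Filter

universe u

/-! ### Edge cuts, rays and edge ends of a simple graph -/

/-- `δ A`: the set of edges of `G` with one vertex in `A` and the other one in the complement. -/
def edgeBoundary {V : Type u} (G : SimpleGraph V) (A : Set V) : Set G.edgeSet :=
  {e | ∃ u v : V, u ∈ A ∧ v ∉ A ∧ (e : Sym2 V) = s(u, v)}

/-- `A` belongs to the Boolean ring of edge cuts of `G`: the set `δ A` is finite. -/
def IsEdgeCut {V : Type u} (G : SimpleGraph V) (A : Set V) : Prop :=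
  (edgeBoundary G A).Finite

/-- A ray: an infinite sequence of distinct vertices, consecutive ones being adjacent. -/
structure GraphRay {V : Type u} (G : SimpleGraph V) where
  vert : ℕ → V
  inj : Function.Injective vert
  adj : ∀ i, G.Adj (vert i) (vert (i + 1))

/-- The ray is eventually in `A`. -/
def GraphRay.EventuallyIn {V : Type u} {G : SimpleGraph V} (R : GraphRay G) (A : Set V) : Prop :=
  ∀ᶠ i in atTop, R.vert i ∈ A

/-- `A` separates the rays `R` and `S`. -/
def SeparatesRays {V : Type u} {G : SimpleGraph V} (A : Set V) (R S : GraphRay G) : Prop :=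
  (R.EventuallyIn A ∧ S.EventuallyIn Aᶜ) ∨ (R.EventuallyIn Aᶜ ∧ S.EventuallyIn A)

theorem GraphRay.not_both {V : Type u} {G : SimpleGraph V} (R : GraphRay G) {A : Set V}
    (h : R.EventuallyIn A) (h' : R.EventuallyIn Aᶜ) : False := by
  obtain ⟨i, hi, hi'⟩ := (h.and h').exists
  exact hi' hi

/-- A ray is eventually on one side of an edge cut. -/
theorem GraphRay.eventuallyIn_or {V : Type u} {G : SimpleGraph V} (R : GraphRay G) {A : Set V}
    (hA : IsEdgeCut G A) : R.EventuallyIn A ∨ R.EventuallyIn Aᶜ := by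
  have hinj : Function.Injective
      (fun i => (⟨s(R.vert i, R.vert (i + 1)), R.adj i⟩ : G.edgeSet)) := by
    intro i j hij
    have h : s(R.vert i, R.vert (i + 1)) = s(R.vert j, R.vert (j + 1)) := congrArg Subtype.val hij
    rcases Sym2.eq_iff.1 h with ⟨h1, _⟩ | ⟨h1, h2⟩
    · exact R.inj h1
    · have := R.inj h1
      have := R.inj h2
      omega
  have hfin := Set.Finite.preimage hinj.injOn hA
  obtain ⟨N, hN⟩ := hfin.bddAbove
  have step : ∀ i, N < i → (R.vert i ∈ A ↔ R.vert (i + 1) ∈ A) := by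
    intro i hi
    by_contra hne
    have hmem : i ∈ (fun i => (⟨s(R.vert i, R.vert (i + 1)), R.adj i⟩ : G.edgeSet)) ⁻¹'
        edgeBoundary G A := by
      by_cases h1 : R.vert i ∈ A
      · exact ⟨_, _, h1, fun h2 => hne ⟨fun _ => h2, fun _ => h1⟩, rfl⟩
      · exact ⟨_, _, by_contra fun h2 => hne ⟨fun h => absurd h h1, fun h => absurd h h2⟩, h1,
          Sym2.eq_swap⟩
    have := hN hmem
    omega
  have all : ∀ i, N + 1 ≤ i → (R.vert i ∈ A ↔ R.vert (N + 1) ∈ A) := by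
    intro i hi
    induction i, hi using Nat.le_induction with
    | base => rfl
    | succ k hk ih => exact (step k (by omega)).symm.trans ih
  by_cases h0 : R.vert (N + 1) ∈ A
  · exact Or.inl (eventually_atTop.2 ⟨N + 1, fun i hi => (all i hi).2 h0⟩)
  · exact Or.inr (eventually_atTop.2 ⟨N + 1, fun i hi h => h0 ((all i hi).1 h)⟩)

/-- Rays are equivalent if no edge cut separates them. -/
def raySetoid {V : Type u} (G : SimpleGraph V) : Setoid (GraphRay G) where
  r R S := ¬ ∃ A, IsEdgeCut G A ∧ SeparatesRays A R S
  iseqv := by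
    refine ⟨?_, ?_, ?_⟩
    · rintro R ⟨A, -, h | h⟩
      · exact R.not_both h.1 h.2
      · exact R.not_both h.2 h.1
    · rintro R S h ⟨A, hA, h1 | h1⟩
      · exact h ⟨A, hA, Or.inr ⟨h1.2, h1.1⟩⟩
      · exact h ⟨A, hA, Or.inl ⟨h1.2, h1.1⟩⟩
    · rintro R S U h h' ⟨A, hA, h1 | h1⟩
      · rcases S.eventuallyIn_or hA with h2 | h2
        · exact h' ⟨A, hA, Or.inl ⟨h2, h1.2⟩⟩
        · exact h ⟨A, hA, Or.inl ⟨h1.1, h2⟩⟩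
      · rcases S.eventuallyIn_or hA with h2 | h2
        · exact h ⟨A, hA, Or.inr ⟨h1.1, h2⟩⟩
        · exact h' ⟨A, hA, Or.inr ⟨h2, h1.2⟩⟩

/-- `Ω G`: the (edge) ends of `G`. -/
def EdgeEnd {V : Type u} (G : SimpleGraph V) : Type u := Quotient (raySetoid G)

/-- `VG ∪ ΩG`: the vertices and the ends of `G`. -/
abbrev GraphPoint {V : Type u} (G : SimpleGraph V) : Type u := V ⊕ EdgeEnd G

/-- A vertex lies in `A` if it belongs to `A`; an end lies in `A` if every ray that represents it
is eventually in `A`. -/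
def LiesIn {V : Type u} {G : SimpleGraph V} (A : Set V) : GraphPoint G → Prop
  | Sum.inl v => v ∈ A
  | Sum.inr ω => ∀ R : GraphRay G, Quotient.mk (raySetoid G) R = ω → R.EventuallyIn A

/-- `A` separates `x` and `y`, each of which is a vertex or an end. -/
def Separates {V : Type u} {G : SimpleGraph V} (A : Set V) (x y : GraphPoint G) : Prop :=
  (LiesIn A x ∧ LiesIn Aᶜ y) ∨ (LiesIn Aᶜ x ∧ LiesIn A y)

/-- Two sets of vertices are nested if one of their four corners is empty. -/
def NestedCuts {V : Type u} (A B : Set V) : Prop :=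
  A ∩ B = ∅ ∨ Aᶜ ∩ B = ∅ ∨ A ∩ Bᶜ = ∅ ∨ Aᶜ ∩ Bᶜ = ∅

/-! ### The action of graph isomorphisms on rays and ends -/

/-- The image of a ray. -/
def GraphRay.map {V W : Type u} {G : SimpleGraph V} {H : SimpleGraph W} (φ : G ≃g H)
    (R : GraphRay G) : GraphRay H where
  vert i := φ (R.vert i)
  inj := φ.injective.comp R.inj
  adj i := φ.map_adj_iff.2 (R.adj i)

theorem IsEdgeCut.preimage {V W : Type u} {G : SimpleGraph V} {H : SimpleGraph W} (φ : G ≃g H)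
    {A : Set W} (hA : IsEdgeCut H A) : IsEdgeCut G (φ ⁻¹' A) := by
  refine (Set.Finite.preimage (f := φ.mapEdgeSet) φ.mapEdgeSet.injective.injOn hA).subset ?_
  rintro e ⟨u, v, hu, hv, he⟩
  refine ⟨φ u, φ v, hu, hv, ?_⟩
  have : ((φ.mapEdgeSet e : H.edgeSet) : Sym2 W) = Sym2.map φ (e : Sym2 V) := rfl
  rw [this, he, Sym2.map_mk]

/-- The image of an end. -/
def EdgeEnd.map {V W : Type u} {G : SimpleGraph V} {H : SimpleGraph W} (φ : G ≃g H) :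
    EdgeEnd G → EdgeEnd H :=
  Quotient.map (sa := raySetoid G) (sb := raySetoid H) (GraphRay.map φ) (by
    rintro R S h ⟨A, hA, h1⟩
    exact h ⟨φ ⁻¹' A, hA.preimage φ, h1⟩)

/-- The map `VG ∪ ΩG → VH ∪ ΩH` induced by an isomorphism. -/
def GraphPoint.map {V W : Type u} {G : SimpleGraph V} {H : SimpleGraph W} (φ : G ≃g H) :
    GraphPoint G → GraphPoint H :=
  Sum.map φ (EdgeEnd.map φ)

/-! ### Networks -/

/-- A network based on a connected simple graph with vertex set `V` (no finiteness condition of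
any kind): every edge has a capacity in `{1, 2, …}`. -/
structure Network (V : Type u) where
  graph : SimpleGraph V
  connected : graph.Connected
  cap : graph.edgeSet → ℕ+

/-- An isomorphism of networks: an isomorphism of graphs that preserves the capacities. -/
structure Network.Iso {V W : Type u} (N : Network V) (M : Network W) where
  toIso : N.graph ≃g M.graph
  cap_eq : ∀ e : N.graph.edgeSet, M.cap (toIso.mapEdgeSet e) = N.cap e

/-- The identity automorphism. -/
def Network.Iso.refl {V : Type u} (N : Network V) : N.Iso N where
  toIso := RelIso.refl _
  cap_eq e := by
    congr 1
    apply Subtype.ext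
    exact congrFun Sym2.map_id (e : Sym2 V)

/-- Composition of isomorphisms (first `φ`, then `ψ`). -/
def Network.Iso.trans {V W U : Type u} {N : Network V} {M : Network W} {L : Network U}
    (φ : N.Iso M) (ψ : M.Iso L) : N.Iso L where
  toIso := φ.toIso.trans ψ.toIso
  cap_eq e := by
    rw [← φ.cap_eq e, ← ψ.cap_eq (φ.toIso.mapEdgeSet e)]
    congr 1
    apply Subtype.ext
    exact (Sym2.map_map (g := ψ.toIso) (f := φ.toIso) (e : Sym2 V)).symm

/-- The capacity `c(A)`: the sum of the capacities of the edges in `δ A`.  It is only used for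
sets `A` such that `δ A` is finite. -/
noncomputable def Network.capacity {V : Type u} (N : Network V) (A : Set V) : ℕ :=
  ∑ᶠ e ∈ edgeBoundary N.graph A, (N.cap e : ℕ)

/-- `A` is a cut with `c(A) ≤ n`. -/
def Network.IsCutLE {V : Type u} (N : Network V) (n : ℕ) (A : Set V) : Prop :=
  IsEdgeCut N.graph A ∧ N.capacity A ≤ n

/-- The Boolean ring `𝓑ₙ` generated by the cuts `A` with `c(A) ≤ n`.  (The subrings with unit of
the Boolean ring of all subsets of `V` are the Boolean subalgebras of `Set V`.) -/
def Network.cutRing {V : Type u} (N : Network V) (n : ℕ) : BooleanSubalgebra (Set V) :=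
  BooleanSubalgebra.closure {A | N.IsCutLE n A}

/-- A cut `A` is thin if it does not belong to the ring that is generated by the cuts of strictly
smaller capacity. -/
def Network.IsThin {V : Type u} (N : Network V) (A : Set V) : Prop :=
  IsEdgeCut N.graph A ∧
    A ∉ BooleanSubalgebra.closure
      {B : Set V | IsEdgeCut N.graph B ∧ N.capacity B < N.capacity A}

/-! ### Structure trees -/

/-- The vertices on the side of the initial vertex of the oriented edge `d`: those that can be
reached from it without using the edge. -/
def initialSide {V : Type u} (T : SimpleGraph V) (d : T.Dart) : Set V :=
  {t | (T.deleteEdges {d.edge}).Reachable d.fst t}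

/-- A network based on a tree whose set of oriented edges is `E`, with the map `ν` from the
vertices and ends of `N` to the vertices and ends of the tree:
* reversing an oriented edge is passing to the complementary cut;
* the capacity of an edge of the tree is the capacity of the corresponding cut of `N`;
* `ν` sends vertices to vertices;
* an oriented edge that corresponds to `A ∈ E` separates, in the tree, the images of the vertices
  and ends of `N` exactly as `A` does in `N` (its initial vertex being on the side of `A`). -/
structure StructureTree {V : Type u} (N : Network V) (E : Set (Set V)) where
  VT : Type u
  net : Network VT
  isTree : net.graph.IsTree
  edgeCut : net.graph.Dart ≃ E
  edgeCut_symm : ∀ d, (edgeCut d.symm : Set V) = (edgeCut d : Set V)ᶜ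
  cap_eq : ∀ d : net.graph.Dart,
    (net.cap ⟨d.edge, d.edge_mem⟩ : ℕ) = N.capacity (edgeCut d : Set V)
  ν : GraphPoint N.graph → GraphPoint net.graph
  ν_vertex : ∀ v : V, ∃ t : VT, ν (Sum.inl v) = Sum.inl t
  side : ∀ (d : net.graph.Dart) (x : GraphPoint N.graph),
    (LiesIn (edgeCut d : Set V) x → LiesIn (initialSide net.graph d) (ν x)) ∧
    (LiesIn (edgeCut d : Set V)ᶜ x → LiesIn (initialSide net.graph d)ᶜ (ν x))

/-! ### Edge boundaries and capacities -/

/-! Write `A*` for the complement of `A`. Capacity is submodular on opposite corners: c(A ∩ B) +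
c(A* ∩ B*) ≤ c(A) + c(B) (`capacity_inter_add_le`). Thin cuts have connected sides, and only
finitely many cuts with connected sides and bounded capacity separate two given vertices
(`finite_separating_of_encard_le`). So a cut crosses only finitely many thin cuts of bounded
capacity (`finite_thin_crossing`), and crossings can be counted.

The candidates at stage n + 1 are the thin cuts of capacity n + 1 nested with all of 𝓔ₙ. Those added
to 𝓔ₙ are the ones outside the ring generated by 𝓔ₙ and the candidates that cross fewer candidates.
Generation: a thin cut of capacity n + 1 that crosses some B in 𝓔ₙ can be traded for a corner that
crosses less of 𝓔ₙ (`exists_corner`), so the candidates suffice; induction on the number of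
crossings then discards the candidates that were not added. Nestedness: for crossing candidates the
number of crossings is strictly submodular (`crossNum_corner_lt`). If two added cuts crossed, enough
of their corners would lie in the lower rings to rebuild one of the two cuts there
(`nested_of_crossNum_le`).

The vertices of the tree are the consistent orientations of 𝓔ₙ that differ finitely from those given
by vertices of X; the edge of A joins two orientations that differ only in the choice between A and
A*. A vertex or end of X orients 𝓔ₙ. This orientation is a node, or some ray of the tree follows it
(`exists_ray`), and the end of that ray is unique (`rays_equiv`). Cuts that do not separate x and y
form a ring, so the generators 𝓔ₙ detect every separation by a cut of capacity at most n. Choices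
affect only representatives, hence everything is canonical. -/

theorem mem_edgeBoundary_mk {V : Type u} {G : SimpleGraph V} {A : Set V} {u v : V}
    (h : G.Adj u v) :
    (⟨s(u, v), h⟩ : G.edgeSet) ∈ edgeBoundary G A ↔ ¬ (u ∈ A ↔ v ∈ A) := by
  constructor
  · rintro ⟨x, y, hx, hy, he⟩
    rcases Sym2.eq_iff.1 he with ⟨h1, h2⟩ | ⟨h1, h2⟩ <;> subst h1 <;> subst h2 <;> tauto
  · intro h1
    by_cases hu : u ∈ A
    · exact ⟨u, v, hu, fun hv => h1 ⟨fun _ => hv, fun _ => hu⟩, rfl⟩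
    · exact ⟨v, u, by_contra fun hv => h1 ⟨fun h => absurd h hu, fun h => absurd h hv⟩, hu,
        Sym2.eq_swap⟩

theorem edgeSet_cases {V : Type u} {G : SimpleGraph V} {p : G.edgeSet → Prop}
    (h : ∀ u v (huv : G.Adj u v), p ⟨s(u, v), huv⟩) (e : G.edgeSet) : p e := by
  obtain ⟨e, he⟩ := e
  induction e using Sym2.ind with
  | _ u v => exact h u v he

theorem edgeBoundary_compl {V : Type u} (G : SimpleGraph V) (A : Set V) :
    edgeBoundary G Aᶜ = edgeBoundary G A := by
  ext e
  revert e
  refine edgeSet_cases fun u v huv => ?_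
  rw [mem_edgeBoundary_mk, mem_edgeBoundary_mk, Set.mem_compl_iff, Set.mem_compl_iff]
  tauto

theorem edgeBoundary_inter_subset {V : Type u} (G : SimpleGraph V) (A B : Set V) :
    edgeBoundary G (A ∩ B) ⊆ edgeBoundary G A ∪ edgeBoundary G B := by
  intro e
  revert e
  refine edgeSet_cases fun u v huv => ?_
  rw [Set.mem_union, mem_edgeBoundary_mk, mem_edgeBoundary_mk, mem_edgeBoundary_mk,
    Set.mem_inter_iff, Set.mem_inter_iff]
  tauto

theorem edgeBoundary_empty {V : Type u} (G : SimpleGraph V) : edgeBoundary G ∅ = ∅ := by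
  ext e
  simp [edgeBoundary]

theorem IsEdgeCut.compl {V : Type u} {G : SimpleGraph V} {A : Set V} (hA : IsEdgeCut G A) :
    IsEdgeCut G Aᶜ := by
  rw [IsEdgeCut, edgeBoundary_compl]
  exact hA

theorem IsEdgeCut.inter {V : Type u} {G : SimpleGraph V} {A B : Set V} (hA : IsEdgeCut G A)
    (hB : IsEdgeCut G B) : IsEdgeCut G (A ∩ B) :=
  (Set.Finite.union hA hB).subset (edgeBoundary_inter_subset G A B)

theorem IsEdgeCut.union {V : Type u} {G : SimpleGraph V} {A B : Set V} (hA : IsEdgeCut G A)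
    (hB : IsEdgeCut G B) : IsEdgeCut G (A ∪ B) := by
  have := (hA.compl.inter hB.compl).compl
  rwa [Set.compl_inter, compl_compl, compl_compl] at this

theorem isEdgeCut_empty {V : Type u} (G : SimpleGraph V) : IsEdgeCut G ∅ := by
  rw [IsEdgeCut, edgeBoundary_empty]
  exact Set.finite_empty

theorem exists_adj_of_reachable {V : Type u} {G : SimpleGraph V} {A : Set V} {u v : V}
    (h : G.Reachable u v) (hu : u ∈ A) (hv : v ∉ A) : ∃ x y, x ∈ A ∧ y ∉ A ∧ G.Adj x y := by
  by_contra hne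
  push Not at hne
  obtain ⟨p⟩ := h
  induction p with
  | nil => exact hv hu
  | @cons a b c hab p ih => exact ih (by_contra fun hb => hne _ _ hu hb hab) hv

namespace Network

theorem capacity_compl {V : Type u} (N : Network V) (A : Set V) :
    N.capacity Aᶜ = N.capacity A := by
  rw [capacity, capacity, edgeBoundary_compl]

open Classical in
theorem capacity_eq_sum {V : Type u} (N : Network V) {A : Set V} (F : Finset N.graph.edgeSet)
    (h : edgeBoundary N.graph A ⊆ F) :
    N.capacity A = ∑ e ∈ F, if e ∈ edgeBoundary N.graph A then (N.cap e : ℕ) else 0 := by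
  rw [capacity, ← Finset.sum_filter]
  refine finsum_mem_eq_sum_of_inter_support_eq _ ?_
  ext e
  simp only [Set.mem_inter_iff, Finset.coe_filter, Set.mem_ofPred_eq]
  exact ⟨fun h1 => ⟨⟨h h1.1, h1.1⟩, h1.2⟩, fun h1 => ⟨h1.1.2, h1.2⟩⟩

/-- The inequality holds edge by edge, according to the corners containing the two endpoints. It is
strict exactly for edges joining `A ∩ Bᶜ` to `Aᶜ ∩ B`, which count twice on the right and not at all
on the left. -/
theorem capacity_inter_add_le {V : Type u} (N : Network V) {A B : Set V}
    (hA : IsEdgeCut N.graph A) (hB : IsEdgeCut N.graph B) :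
    N.capacity (A ∩ B) + N.capacity (Aᶜ ∩ Bᶜ) ≤ N.capacity A + N.capacity B := by
  classical
  obtain ⟨F, hF⟩ := (Set.Finite.union hA hB).exists_finset_coe
  have h1 : edgeBoundary N.graph A ⊆ F := by rw [hF]; exact Set.subset_union_left
  have h2 : edgeBoundary N.graph B ⊆ F := by rw [hF]; exact Set.subset_union_right
  have h3 : edgeBoundary N.graph (A ∩ B) ⊆ F := by
    rw [hF]; exact edgeBoundary_inter_subset _ _ _
  have h4 : edgeBoundary N.graph (Aᶜ ∩ Bᶜ) ⊆ F := by
    rw [hF, ← edgeBoundary_compl _ A, ← edgeBoundary_compl _ B]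
    exact edgeBoundary_inter_subset _ _ _
  rw [N.capacity_eq_sum F h1, N.capacity_eq_sum F h2, N.capacity_eq_sum F h3,
    N.capacity_eq_sum F h4, ← Finset.sum_add_distrib, ← Finset.sum_add_distrib]
  refine Finset.sum_le_sum fun e _ => ?_
  revert e
  refine edgeSet_cases fun u v huv => ?_
  simp only [mem_edgeBoundary_mk, Set.mem_inter_iff, Set.mem_compl_iff]
  by_cases h1 : u ∈ A <;> by_cases h2 : v ∈ A <;> by_cases h3 : u ∈ B <;> by_cases h4 : v ∈ B <;>
    simp [h1, h2, h3, h4]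

/-- Splitting a cut into two parts that are not joined by an edge. -/
theorem capacity_split {V : Type u} (N : Network V) {A D : Set V} (hA : IsEdgeCut N.graph A)
    (hD : D ⊆ A) (h : ∀ u ∈ D, ∀ v ∈ A \ D, ¬ N.graph.Adj u v) :
    IsEdgeCut N.graph D ∧ IsEdgeCut N.graph (A \ D) ∧
      N.capacity A = N.capacity D + N.capacity (A \ D) := by
  classical
  have h1 : edgeBoundary N.graph D ⊆ edgeBoundary N.graph A := by
    intro e
    revert e
    refine edgeSet_cases fun u v huv => ?_
    rw [mem_edgeBoundary_mk, mem_edgeBoundary_mk]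
    have := h u; have := h v; have := @hD u; have := @hD v; have := huv.symm
    simp only [Set.mem_sdiff] at *
    grind
  have h2 : edgeBoundary N.graph (A \ D) ⊆ edgeBoundary N.graph A := by
    intro e
    revert e
    refine edgeSet_cases fun u v huv => ?_
    rw [mem_edgeBoundary_mk, mem_edgeBoundary_mk]
    have := h u; have := h v; have := @hD u; have := @hD v; have := huv.symm
    simp only [Set.mem_sdiff] at *
    grind
  refine ⟨Set.Finite.subset hA h1, Set.Finite.subset hA h2, ?_⟩
  obtain ⟨F, hF⟩ := Set.Finite.exists_finset_coe hA
  rw [N.capacity_eq_sum F hF.ge, N.capacity_eq_sum F (h1.trans hF.ge),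
    N.capacity_eq_sum F (h2.trans hF.ge), ← Finset.sum_add_distrib]
  refine Finset.sum_congr rfl fun e _ => ?_
  revert e
  refine edgeSet_cases fun u v huv => ?_
  have := h u; have := h v; have := @hD u; have := @hD v; have := huv.symm
  simp only [mem_edgeBoundary_mk, Set.mem_sdiff] at *
  grind

theorem capacity_pos {V : Type u} (N : Network V) {A : Set V} (hA : IsEdgeCut N.graph A)
    (h : A.Nonempty) (h' : Aᶜ.Nonempty) : 0 < N.capacity A := by
  classical
  obtain ⟨F, hF⟩ := Set.Finite.exists_finset_coe hA
  obtain ⟨u, hu⟩ := h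
  obtain ⟨v, hv⟩ := h'
  obtain ⟨x, y, hx, hy, hxy⟩ := exists_adj_of_reachable (N.connected.preconnected u v) hu hv
  have hmem : (⟨s(x, y), hxy⟩ : N.graph.edgeSet) ∈ edgeBoundary N.graph A := ⟨x, y, hx, hy, rfl⟩
  rw [N.capacity_eq_sum F hF.ge]
  refine Finset.sum_pos' (fun _ _ => Nat.zero_le _) ⟨⟨s(x, y), hxy⟩, ?_, ?_⟩
  · have : (⟨s(x, y), hxy⟩ : N.graph.edgeSet) ∈ (F : Set N.graph.edgeSet) := hF ▸ hmem
    exact this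
  · rw [if_pos hmem]
    exact (N.cap _).pos

theorem ncard_edgeBoundary_le {V : Type u} (N : Network V) {A : Set V}
    (hA : IsEdgeCut N.graph A) : (edgeBoundary N.graph A).ncard ≤ N.capacity A := by
  classical
  obtain ⟨F, hF⟩ := Set.Finite.exists_finset_coe hA
  rw [N.capacity_eq_sum F hF.ge, ← hF, Set.ncard_coe_finset, Finset.card_eq_sum_ones]
  refine Finset.sum_le_sum fun e he => ?_
  rw [if_pos (Finset.mem_coe.2 he)]
  exact (N.cap e).pos

end Network

/-! ### Connected sets of vertices and finiteness -/

/-- `A` induces a connected subgraph (or is empty): it has no proper part that is not joined to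
the rest of `A` by an edge. -/
def IsUnsplit {V : Type u} (G : SimpleGraph V) (A : Set V) : Prop :=
  ∀ D ⊆ A, (∀ u ∈ D, ∀ v ∈ A \ D, ¬ G.Adj u v) → D = ∅ ∨ D = A

/-- The oriented edges that leave `A`. -/
def outEdges {V : Type u} (G : SimpleGraph V) (A : Set V) : Set (V × V) :=
  {p | p.1 ∈ A ∧ p.2 ∉ A ∧ G.Adj p.1 p.2}

theorem exists_bijective_outEdges {V : Type u} (G : SimpleGraph V) (A : Set V) :
    ∃ f : outEdges G A → edgeBoundary G A, Function.Bijective f := by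
  refine ⟨fun p => ⟨⟨s(p.1.1, p.1.2), p.2.2.2⟩, p.1.1, p.1.2, p.2.1, p.2.2.1, rfl⟩, ?_, ?_⟩
  · rintro ⟨⟨a, b⟩, ha, hb, hab⟩ ⟨⟨c, d⟩, hc, hd, hcd⟩ h
    have h' : s(a, b) = s(c, d) := congrArg (fun e => (e.1 : Sym2 V)) h
    rcases Sym2.eq_iff.1 h' with ⟨h1, h2⟩ | ⟨h1, h2⟩
    · subst h1; subst h2; rfl
    · subst h1; exact absurd ha hd
  · rintro ⟨⟨e, he⟩, u, v, hu, hv, huv⟩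
    dsimp only at huv
    subst huv
    exact ⟨⟨(u, v), hu, hv, he⟩, rfl⟩

/-- A connected `A` stays inside the component of `u`, and a connected `Aᶜ` stays inside that of
`v`; as these components differ, `A` fills the first one. -/
theorem IsUnsplit.eq_setOf_reachable {V : Type u} {G : SimpleGraph V} {A : Set V} {u v : V}
    (hr : ¬ G.Reachable u v) (hu : u ∈ A) (hv : v ∉ A) (hA : IsUnsplit G A)
    (hA' : IsUnsplit G Aᶜ) : A = {w | G.Reachable u w} := by
  have key : ∀ (B : Set V) (a : V), a ∈ B → IsUnsplit G B → ∀ w ∈ B, G.Reachable a w := by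
    intro B a ha hB w hw
    rcases hB {w ∈ B | G.Reachable a w} (fun w hw => hw.1)
      (fun x hx y hy hxy => hy.2 ⟨hy.1, hx.2.trans hxy.reachable⟩) with h | h
    · exact (h.le (⟨ha, SimpleGraph.Reachable.refl a⟩ : a ∈ {w ∈ B | G.Reachable a w})).elim
    · exact (h.ge hw).2
  ext w
  refine ⟨fun hw => key A u hu hA w hw, fun hw => by_contra fun hwA => ?_⟩
  exact hr (SimpleGraph.Reachable.trans hw (key Aᶜ v hv hA' w hwA).symm)

/-- The deleted edge does not have both ends in `A`, so the subgraph induced on `A` is unchanged. -/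
theorem IsUnsplit.deleteEdges {V : Type u} {G : SimpleGraph V} {A : Set V} {x y : V}
    (h : x ∉ A ∨ y ∉ A) (hA : IsUnsplit G A) : IsUnsplit (G.deleteEdges {s(x, y)}) A := by
  refine fun D hD hne => hA D hD fun u hu v hv huv => hne u hu v hv ?_
  rw [SimpleGraph.deleteEdges_adj]
  refine ⟨huv, fun h1 => ?_⟩
  rcases Sym2.eq_iff.1 h1 with ⟨h1, h2⟩ | ⟨h1, h2⟩ <;> subst h1 <;> subst h2
  · exact h.elim (fun h => h (hD hu)) (fun h => h hv.1)
  · exact h.elim (fun h => h hv.1) (fun h => h (hD hu))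

/-- Only finitely many cuts with connected sides and a bounded number of edges separate two given
vertices. -/
theorem finite_separating_of_encard_le {V : Type u} (k : ℕ) : ∀ (G : SimpleGraph V) (u v : V),
    {A : Set V | u ∈ A ∧ v ∉ A ∧ IsUnsplit G A ∧ IsUnsplit G Aᶜ ∧
      (outEdges G A).encard ≤ k}.Finite := by
  induction k with
  | zero =>
    intro G u v
    by_cases hr : G.Reachable u v
    · refine Set.Finite.subset Set.finite_empty ?_
      rintro A ⟨hu, hv, -, -, h⟩
      obtain ⟨x, y, hx, hy, hxy⟩ := exists_adj_of_reachable hr hu hv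
      have h0 : outEdges G A = ∅ := by simpa using h
      have : (x, y) ∈ outEdges G A := ⟨hx, hy, hxy⟩
      rw [h0] at this
      exact this.elim
    · refine Set.Finite.subset (Set.finite_singleton {w | G.Reachable u w}) ?_
      rintro A ⟨hu, hv, h1, h2, -⟩
      exact h1.eq_setOf_reachable hr hu hv h2
  | succ k ih =>
    intro G u v
    by_cases hr : G.Reachable u v
    · obtain ⟨p⟩ := hr
      induction p with
      | nil =>
        refine Set.Finite.subset Set.finite_empty ?_
        rintro A ⟨hu, hv, -⟩
        exact hv hu
      | @cons x y z hxy p ihp =>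
        -- Along a path from `x` to `z`, a cut either separates the first edge, and deleting that
        -- edge lowers the count of leaving edges by one, or it separates `y` from `z`. Deletion may
        -- disconnect the graph, which is why the induction ranges over all graphs.
        refine ((ih (G.deleteEdges {s(x, y)}) x y).union ihp).subset ?_
        rintro A ⟨hx, hz, h1, h2, h3⟩
        by_cases hy : y ∈ A
        · exact Or.inr ⟨hy, hz, h1, h2, h3⟩
        · refine Or.inl ⟨hx, hy, h1.deleteEdges (Or.inr hy),
            h2.deleteEdges (Or.inl (fun h => h hx)), ?_⟩
          have hsub : outEdges (G.deleteEdges {s(x, y)}) A ⊆ outEdges G A \ {(x, y)} := by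
            rintro ⟨a, b⟩ ⟨ha, hb, hab⟩
            rw [SimpleGraph.deleteEdges_adj] at hab
            refine ⟨⟨ha, hb, hab.1⟩, fun h => hab.2 ?_⟩
            rw [Set.mem_singleton_iff, Prod.mk.injEq] at h
            rw [h.1, h.2]
            rfl
          have hmem : (x, y) ∈ outEdges G A := ⟨hx, hy, hxy⟩
          have h4 := Set.encard_sdiff_singleton_add_one hmem
          have h5 := Set.encard_le_encard hsub
          have h6 : (outEdges G A \ {(x, y)}).encard + 1 ≤ (k : ℕ∞) + 1 := by
            rw [h4]
            exact_mod_cast h3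
          exact h5.trans ((ENat.add_le_add_iff_right (by simp)).1 h6)
    · refine Set.Finite.subset (Set.finite_singleton {w | G.Reachable u w}) ?_
      rintro A ⟨hu, hv, h1, h2, -⟩
      exact h1.eq_setOf_reachable hr hu hv h2

/-! ### Nested pairs -/

theorem NestedCuts.symm {V : Type u} {A B : Set V} (h : NestedCuts A B) : NestedCuts B A := by
  unfold NestedCuts at *
  rw [Set.inter_comm B A, Set.inter_comm Bᶜ A, Set.inter_comm B Aᶜ, Set.inter_comm Bᶜ Aᶜ]
  tauto

theorem NestedCuts.compl_left {V : Type u} {A B : Set V} (h : NestedCuts A B) :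
    NestedCuts Aᶜ B := by
  unfold NestedCuts at *
  rw [compl_compl]
  tauto

theorem nestedCuts_compl_left {V : Type u} {A B : Set V} :
    NestedCuts Aᶜ B ↔ NestedCuts A B :=
  ⟨fun h => by simpa using h.compl_left, fun h => h.compl_left⟩

theorem NestedCuts.compl_right {V : Type u} {A B : Set V} (h : NestedCuts A B) :
    NestedCuts A Bᶜ :=
  h.symm.compl_left.symm

theorem nestedCuts_compl_right {V : Type u} {A B : Set V} :
    NestedCuts A Bᶜ ↔ NestedCuts A B :=
  ⟨fun h => by simpa using h.compl_right, fun h => h.compl_right⟩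

/-- In terms of inclusions. -/
theorem nestedCuts_iff {V : Type u} {A B : Set V} :
    NestedCuts A B ↔ A ⊆ Bᶜ ∨ B ⊆ A ∨ A ⊆ B ∨ Aᶜ ⊆ B := by
  unfold NestedCuts
  simp only [← Set.disjoint_iff_inter_eq_empty, Set.disjoint_compl_right_iff_subset,
    Set.disjoint_compl_left_iff_subset, Set.subset_compl_iff_disjoint_right]

/-- A cut that is nested with two crossing cuts is nested with their corners. -/
theorem NestedCuts.inter {V : Type u} {A B C : Set V} (hAB : ¬ NestedCuts A B)
    (hA : NestedCuts A C) (hB : NestedCuts B C) : NestedCuts (A ∩ B) C := by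
  rw [nestedCuts_iff] at *
  rcases hA with h | h | h | h
  · exact Or.inl (Set.inter_subset_left.trans h)
  · rcases hB with h' | h' | h' | h'
    · exact Or.inl (Set.inter_subset_right.trans h')
    · exact Or.inr (Or.inl (Set.subset_inter h h'))
    · exact Or.inr (Or.inr (Or.inl (Set.inter_subset_right.trans h')))
    -- Here `Bᶜ ⊆ C ⊆ A`; the other contradictory cases likewise chain through `C` and make `A` and
    -- `B` nested.
    · exact absurd (Or.inr (Or.inr (Or.inr (Set.compl_subset_comm.1 (h'.trans h))))) hAB
  · exact Or.inr (Or.inr (Or.inl (Set.inter_subset_left.trans h)))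
  · rcases hB with h' | h' | h' | h'
    · exact absurd (Or.inr (Or.inl (Set.compl_subset_compl.1
        (h.trans (Set.subset_compl_comm.1 h'))))) hAB
    · exact absurd (Or.inr (Or.inr (Or.inr (h.trans h')))) hAB
    · exact Or.inr (Or.inr (Or.inl (Set.inter_subset_right.trans h')))
    · exact Or.inr (Or.inr (Or.inr (by rw [Set.compl_inter]; exact Set.union_subset h h')))

/-- A cut that is nested with `A` is nested with one of two opposite corners of `A` and `B`. -/
theorem NestedCuts.inter_or {V : Type u} {A C : Set V} (B : Set V) (hA : NestedCuts A C) :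
    NestedCuts (A ∩ B) C ∨ NestedCuts (Aᶜ ∩ Bᶜ) C := by
  rw [nestedCuts_iff] at hA
  rcases hA with h | h | h | h
  · exact Or.inl (nestedCuts_iff.2 (Or.inl (Set.inter_subset_left.trans h)))
  · exact Or.inr (nestedCuts_iff.2
      (Or.inl (Set.inter_subset_left.trans (Set.compl_subset_compl.2 h))))
  · exact Or.inl (nestedCuts_iff.2 (Or.inr (Or.inr (Or.inl (Set.inter_subset_left.trans h)))))
  · exact Or.inr (nestedCuts_iff.2 (Or.inr (Or.inr (Or.inl (Set.inter_subset_left.trans h)))))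

theorem nestedCuts_inter_self {V : Type u} (A B : Set V) : NestedCuts (A ∩ B) A :=
  nestedCuts_iff.2 (Or.inr (Or.inr (Or.inl Set.inter_subset_left)))

/-! ### Thin cuts -/

namespace Network

variable {V : Type u} {N : Network V} {A B C : Set V} {n : ℕ}

theorem IsThin.compl (h : N.IsThin A) : N.IsThin Aᶜ := by
  refine ⟨h.1.compl, ?_⟩
  rw [capacity_compl, BooleanSubalgebra.compl_mem_iff]
  exact h.2

theorem IsThin.nonempty (h : N.IsThin A) : A.Nonempty := by
  rw [Set.nonempty_iff_ne_empty]
  rintro rfl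
  exact h.2 BooleanSubalgebra.bot_mem

/-- If `A` splits into two nonempty parts with no edge between them, their capacities are positive
and add up to that of `A`. Both parts are then cuts of smaller capacity whose union is `A`. -/
theorem IsThin.isUnsplit (h : N.IsThin A) : IsUnsplit N.graph A := by
  intro D hD hne
  by_contra hcon
  push Not at hcon
  obtain ⟨h1, h2⟩ := hcon
  obtain ⟨hD1, hD2, hcap⟩ := N.capacity_split h.1 hD hne
  have hD' : (A \ D).Nonempty := Set.sdiff_nonempty.2 fun h3 => h2 (hD.antisymm h3)
  have hp1 := N.capacity_pos hD1 h1 (hD'.mono fun x hx => hx.2)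
  have hp2 := N.capacity_pos hD2 hD' (h1.mono fun x hx h3 => h3.2 hx)
  refine h.2 ?_
  have : A = D ⊔ (A \ D) := (Set.union_sdiff_cancel hD).symm
  rw [this]
  refine BooleanSubalgebra.sup_mem (BooleanSubalgebra.subset_closure ⟨hD1, ?_⟩)
    (BooleanSubalgebra.subset_closure ⟨hD2, ?_⟩)
  · rw [← this]; omega
  · rw [← this]; omega

theorem encard_outEdges_le (hA : IsEdgeCut N.graph A) :
    (outEdges N.graph A).encard ≤ N.capacity A := by
  obtain ⟨f, hf⟩ := exists_bijective_outEdges N.graph A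
  have h1 : (outEdges N.graph A).encard = (edgeBoundary N.graph A).encard :=
    Set.encard_congr (Equiv.ofBijective f hf)
  rw [h1, ← Set.Finite.cast_ncard_eq hA]
  exact_mod_cast N.ncard_edgeBoundary_le hA

theorem finite_thin_separating (N : Network V) (n : ℕ) (u v : V) :
    {A : Set V | N.IsThin A ∧ N.capacity A ≤ n ∧ u ∈ A ∧ v ∉ A}.Finite := by
  refine (finite_separating_of_encard_le n N.graph u v).subset ?_
  rintro A ⟨h1, h2, hu, hv⟩
  exact ⟨hu, hv, h1.isUnsplit, h1.compl.isUnsplit,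
    (encard_outEdges_le h1.1).trans (by exact_mod_cast h2)⟩

/-- Only finitely many thin cuts of bounded capacity cross a given cut. -/
theorem finite_thin_crossing (hA : IsEdgeCut N.graph A) (n : ℕ) :
    {C : Set V | N.IsThin C ∧ N.capacity C ≤ n ∧ ¬ NestedCuts A C}.Finite := by
  have hfin : (outEdges N.graph A).Finite :=
    Set.finite_of_encard_le_coe (encard_outEdges_le hA)
  set S : Set V := Prod.fst '' outEdges N.graph A ∪ Prod.snd '' outEdges N.graph A with hS
  have hSfin : S.Finite := (hfin.image _).union (hfin.image _)
  -- If `C` avoids all endpoints of `δ A`, no edge joins `C ∩ A` to `C \ A`, so connectedness puts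
  -- `C` on one side of `A`. A thin cut crossing `A` must therefore separate two vertices of the
  -- finite set `S`.
  have key : ∀ C : Set V, N.IsThin C → (∀ s ∈ S, s ∉ C) → NestedCuts A C := by
    intro C hC h
    have := hC.isUnsplit (C ∩ A) Set.inter_subset_left (by
      intro u hu v hv huv
      exact h u (Or.inl ⟨(u, v), ⟨hu.2, fun h1 => hv.2 ⟨hv.1, h1⟩, huv⟩, rfl⟩) hu.1)
    rcases this with h1 | h1
    · exact Or.inl (by rw [Set.inter_comm, h1])
    · exact nestedCuts_iff.2 (Or.inr (Or.inl (Set.inter_eq_left.1 h1)))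
  refine (hSfin.biUnion fun s _ => hSfin.biUnion fun t _ =>
    N.finite_thin_separating n s t).subset ?_
  rintro C ⟨hC, hn, hne⟩
  have h1 : ∃ s ∈ S, s ∈ C := by
    by_contra h
    push Not at h
    exact hne (key C hC h)
  have h2 : ∃ t ∈ S, t ∉ C := by
    by_contra h
    push Not at h
    exact hne (nestedCuts_compl_right.1 (key Cᶜ hC.compl fun s hs h3 => h3 (h s hs)))
  obtain ⟨s, hs, hsC⟩ := h1
  obtain ⟨t, ht, htC⟩ := h2
  simp only [Set.mem_iUnion]
  exact ⟨s, hs, t, ht, hC, hn, hsC, htC⟩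

end Network

/-! ### Uncrossing a thin cut with a thin cut of smaller capacity -/

namespace Network

variable {V : Type u} {N : Network V} {A B C X : Set V} {n m : ℕ} {S : Set (Set V)}

theorem mem_cutRing (hA : IsEdgeCut N.graph A) (h : N.capacity A ≤ n) : A ∈ N.cutRing n :=
  BooleanSubalgebra.subset_closure ⟨hA, h⟩

theorem lt_capacity_of_notMem (hA : IsEdgeCut N.graph A) (h : A ∉ N.cutRing n) :
    n < N.capacity A :=
  lt_of_not_ge fun h1 => h (mem_cutRing hA h1)

theorem IsThin.notMem_cutRing (hA : N.IsThin A) (h : n < N.capacity A) : A ∉ N.cutRing n := by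
  have hsub : {B | N.IsCutLE n B} ⊆
      {B | IsEdgeCut N.graph B ∧ N.capacity B < N.capacity A} :=
    fun _ hB => ⟨hB.1, hB.2.trans_lt h⟩
  exact fun h1 => hA.2 (BooleanSubalgebra.closure_mono hsub h1)

/-- This is how corners are recognised as thin: a capacity bound from submodularity together with
non-membership in 𝓑ₙ. Capacity below n + 1 means capacity at most n, so the ring in the definition
of thinness is `cutRing n`. -/
theorem isThin_of_notMem (hA : IsEdgeCut N.graph A) (h : A ∉ N.cutRing n)
    (h' : N.capacity A ≤ n + 1) : N.IsThin A ∧ N.capacity A = n + 1 := by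
  have h1 := lt_capacity_of_notMem hA h
  have h2 : N.capacity A = n + 1 := by omega
  refine ⟨⟨hA, ?_⟩, h2⟩
  rw [h2]
  simpa only [Nat.lt_succ_iff, cutRing, IsCutLE] using h

theorem IsThin.capacity_pos (hA : N.IsThin A) : 0 < N.capacity A :=
  N.capacity_pos hA.1 hA.nonempty hA.compl.nonempty

theorem cutRing_zero (N : Network V) : N.cutRing 0 = ⊥ := by
  refine le_bot_iff.1 (BooleanSubalgebra.closure_le.2 ?_)
  rintro A ⟨hA, h0⟩
  by_contra h1
  have h2 : ¬ (A = ⊥ ∨ A = ⊤) := h1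
  push Not at h2
  have := N.capacity_pos hA (Set.nonempty_iff_ne_empty.2 h2.1) (Set.nonempty_compl.2 h2.2)
  omega

theorem capacity_inter_add_le' (hA : IsEdgeCut N.graph A) (hB : IsEdgeCut N.graph B) :
    N.capacity (A ∩ Bᶜ) + N.capacity (Aᶜ ∩ B) ≤ N.capacity A + N.capacity B := by
  have := N.capacity_inter_add_le hA hB.compl
  rwa [compl_compl, capacity_compl] at this

theorem inter_mem_or (R : BooleanSubalgebra (Set V)) (B : Set V) (h : A ∉ R) :
    A ∩ B ∉ R ∨ A ∩ Bᶜ ∉ R := by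
  by_contra hcon
  push Not at hcon
  refine h ?_
  rw [← Set.inter_union_compl A B]
  exact BooleanSubalgebra.sup_mem hcon.1 hcon.2

/-- A set `X` that is nested with everything that is nested with both `A` and `B`, and with
`B` itself. -/
def IsCornerLike (A B X : Set V) : Prop :=
  ¬ NestedCuts A B → NestedCuts X B ∧
    ∀ C, NestedCuts A C → NestedCuts B C → NestedCuts X C

theorem isCornerLike_inter (A B : Set V) : IsCornerLike A B (A ∩ B) := fun hAB =>
  ⟨by rw [Set.inter_comm]; exact nestedCuts_inter_self B A, fun _ hA hB => hA.inter hAB hB⟩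

theorem IsCornerLike.of_compl_left (h : IsCornerLike Aᶜ B X) : IsCornerLike A B X := fun hAB =>
  ⟨(h (fun h1 => hAB (nestedCuts_compl_left.1 h1))).1, fun C hA hB =>
    (h (fun h1 => hAB (nestedCuts_compl_left.1 h1))).2 C hA.compl_left hB⟩

theorem IsCornerLike.of_compl_right (h : IsCornerLike A Bᶜ X) : IsCornerLike A B X := fun hAB =>
  ⟨nestedCuts_compl_right.1 (h (fun h1 => hAB (nestedCuts_compl_right.1 h1))).1, fun C hA hB =>
    (h (fun h1 => hAB (nestedCuts_compl_right.1 h1))).2 C hA hB.compl_left⟩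

/-- Both corners inside `B` have capacity at least n + 1, so by submodularity the corners inside
`Bᶜ` have capacity at most c(B) and lie in 𝓑ₙ. As `B` is thin, one of the latter has capacity at
least c(B), and submodularity bounds the corner opposite to it by n + 1. That opposite corner is
`X`; adjoining a corner from 𝓑ₙ to it gives `A` or `Aᶜ`. -/
theorem exists_corner_of_notMem (hA : N.IsThin A) (hAn : N.capacity A = n + 1)
    (hB : N.IsThin B) (hBn : N.capacity B ≤ n) (h1 : A ∩ B ∉ N.cutRing n)
    (h2 : Aᶜ ∩ B ∉ N.cutRing n) :
    ∃ X, N.IsThin X ∧ N.capacity X = n + 1 ∧ IsCornerLike A B X ∧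
      A ∈ BooleanSubalgebra.closure ((N.cutRing n : Set (Set V)) ∪ {X}) := by
  have hc1 := lt_capacity_of_notMem (hA.1.inter hB.1) h1
  have hc2 := lt_capacity_of_notMem (hA.compl.1.inter hB.1) h2
  have hs1 := N.capacity_inter_add_le hA.1 hB.1
  have hs2 := capacity_inter_add_le' hA.1 hB.1
  have hpos := hB.capacity_pos
  obtain ⟨m, hm⟩ : ∃ m, N.capacity B = m + 1 := ⟨N.capacity B - 1, by omega⟩
  have hBm : Bᶜ ∉ N.cutRing m := hB.compl.notMem_cutRing (by rw [capacity_compl]; omega)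
  have hring : ∀ Y Z : Set V, Y ∈ N.cutRing n →
      Y ∪ Z ∈ BooleanSubalgebra.closure ((N.cutRing n : Set (Set V)) ∪ {Z}) := fun Y Z hY =>
    BooleanSubalgebra.sup_mem (BooleanSubalgebra.subset_closure (Or.inl hY))
      (BooleanSubalgebra.subset_closure (Or.inr rfl))
  have hm1 : A ∩ Bᶜ ∈ N.cutRing n := mem_cutRing (hA.1.inter hB.compl.1) (by omega)
  have hm2 : Aᶜ ∩ Bᶜ ∈ N.cutRing n := mem_cutRing (hA.compl.1.inter hB.compl.1) (by omega)
  rcases inter_mem_or (N.cutRing m) A hBm with h | h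
  · rw [Set.inter_comm] at h
    have hc := lt_capacity_of_notMem (hA.1.inter hB.compl.1) h
    obtain ⟨ht, hcap⟩ := isThin_of_notMem (hA.compl.1.inter hB.1) h2 (by omega)
    refine ⟨_, ht, hcap, (isCornerLike_inter _ _).of_compl_left, ?_⟩
    have := hring _ (Aᶜ ∩ B) hm2
    rw [Set.union_comm (Aᶜ ∩ Bᶜ), Set.inter_union_compl] at this
    exact BooleanSubalgebra.compl_mem_iff.1 this
  · rw [Set.inter_comm] at h
    have hc := lt_capacity_of_notMem (hA.compl.1.inter hB.compl.1) h
    obtain ⟨ht, hcap⟩ := isThin_of_notMem (hA.1.inter hB.1) h1 (by omega)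
    refine ⟨_, ht, hcap, isCornerLike_inter _ _, ?_⟩
    have := hring _ (A ∩ B) hm1
    rwa [Set.union_comm (A ∩ Bᶜ), Set.inter_union_compl] at this

/-- One corner in each of `A` and `Aᶜ` is outside 𝓑ₙ. Two such corners cannot be opposite, since
their capacities would sum to at least 2n + 2 while c(A) + c(B) ≤ 2n + 1. So they lie on the same
side of `B`. -/
theorem exists_corner (hA : N.IsThin A) (hAn : N.capacity A = n + 1)
    (hB : N.IsThin B) (hBn : N.capacity B ≤ n) :
    ∃ X, N.IsThin X ∧ N.capacity X = n + 1 ∧ IsCornerLike A B X ∧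
      A ∈ BooleanSubalgebra.closure ((N.cutRing n : Set (Set V)) ∪ {X}) := by
  have hR : A ∉ N.cutRing n := hA.notMem_cutRing (by omega)
  have hR' : Aᶜ ∉ N.cutRing n := fun h => hR (BooleanSubalgebra.compl_mem_iff.1 h)
  rcases inter_mem_or _ B hR with h1 | h1 <;> rcases inter_mem_or _ B hR' with h2 | h2
  · exact exists_corner_of_notMem hA hAn hB hBn h1 h2
  · have hc1 := lt_capacity_of_notMem (hA.1.inter hB.1) h1
    have hc2 := lt_capacity_of_notMem (hA.compl.1.inter hB.compl.1) h2
    have := N.capacity_inter_add_le hA.1 hB.1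
    omega
  · have hc1 := lt_capacity_of_notMem (hA.1.inter hB.compl.1) h1
    have hc2 := lt_capacity_of_notMem (hA.compl.1.inter hB.1) h2
    have := capacity_inter_add_le' hA.1 hB.1
    omega
  · obtain ⟨X, hX, hXn, hc, hmem⟩ := exists_corner_of_notMem hA hAn hB.compl
      (by rwa [capacity_compl]) h1 h2
    exact ⟨X, hX, hXn, hc.of_compl_right, hmem⟩

/-! ### The canonical nested set of thin cuts -/

/-- The thin cuts of capacity `n + 1` that are nested with the elements of `S`. -/
def candidates (N : Network V) (n : ℕ) (S : Set (Set V)) : Set (Set V) :=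
  {A | N.IsThin A ∧ N.capacity A = n + 1 ∧ ∀ B ∈ S, NestedCuts A B}

/-- The number of elements of `S` that are not nested with `A`. -/
noncomputable def crossNum (S : Set (Set V)) (A : Set V) : ℕ :=
  {B ∈ S | ¬ NestedCuts A B}.ncard

/-- The ring generated by `S` and the candidates that cross fewer candidates than `A` does. -/
noncomputable def lowerRing (N : Network V) (n : ℕ) (S : Set (Set V)) (A : Set V) :
    BooleanSubalgebra (Set V) :=
  BooleanSubalgebra.closure (S ∪ {X ∈ N.candidates n S |
    crossNum (N.candidates n S) X < crossNum (N.candidates n S) A})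

/-- The canonical nested sets of thin cuts. -/
noncomputable def nestedCutSet (N : Network V) : ℕ → Set (Set V)
  | 0 => ∅
  | n + 1 => N.nestedCutSet n ∪
      {A ∈ N.candidates n (N.nestedCutSet n) | A ∉ N.lowerRing n (N.nestedCutSet n) A}

/-- `S` is a nested set of thin cuts of capacity at most `n` that generates `𝓑ₙ`. -/
structure IsNestedGenerating (N : Network V) (n : ℕ) (S : Set (Set V)) : Prop where
  isThin : ∀ A ∈ S, N.IsThin A
  capacity_le : ∀ A ∈ S, N.capacity A ≤ n
  compl_mem : ∀ A ∈ S, Aᶜ ∈ S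
  nested : ∀ A ∈ S, ∀ B ∈ S, NestedCuts A B
  closure_eq : BooleanSubalgebra.closure S = N.cutRing n

theorem crossNum_compl (S : Set (Set V)) (A : Set V) : crossNum S Aᶜ = crossNum S A := by
  simp only [crossNum, nestedCuts_compl_left]

theorem candidates_compl (h : A ∈ N.candidates n S) : Aᶜ ∈ N.candidates n S :=
  ⟨h.1.compl, by rw [capacity_compl]; exact h.2.1, fun B hB => (h.2.2 B hB).compl_left⟩

theorem lowerRing_compl (N : Network V) (n : ℕ) (S : Set (Set V)) (A : Set V) :
    N.lowerRing n S Aᶜ = N.lowerRing n S A := by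
  simp only [lowerRing, crossNum_compl]

theorem lowerRing_mono (h : crossNum (N.candidates n S) A ≤ crossNum (N.candidates n S) B) :
    N.lowerRing n S A ≤ N.lowerRing n S B :=
  BooleanSubalgebra.closure_mono (Set.union_subset_union_right _
    fun _ hX => ⟨hX.1, hX.2.trans_le h⟩)

theorem candidates_finite (hA : IsEdgeCut N.graph A) :
    {B ∈ N.candidates n S | ¬ NestedCuts A B}.Finite :=
  (finite_thin_crossing hA (n + 1)).subset fun _ hB => ⟨hB.1.1, hB.1.2.1.le, hB.2⟩

/-- The capacity-`(n + 1)` candidates generate, together with the cuts of capacity at most `n`. -/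
theorem mem_closure_candidates (hS : N.IsNestedGenerating n S) :
    ∀ (k : ℕ) (A : Set V), crossNum S A = k → N.IsThin A → N.capacity A = n + 1 →
      A ∈ BooleanSubalgebra.closure (S ∪ N.candidates n S) := by
  intro k
  induction k using Nat.strong_induction_on with
  | _ k ih =>
    intro A hk hA hAn
    by_cases hcand : A ∈ N.candidates n S
    · exact BooleanSubalgebra.subset_closure (Or.inr hcand)
    obtain ⟨B, hB, hAB⟩ : ∃ B ∈ S, ¬ NestedCuts A B := by
      by_contra h
      push Not at h
      exact hcand ⟨hA, hAn, h⟩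
    obtain ⟨X, hX, hXn, hc, hmem⟩ := exists_corner hA hAn (hS.isThin B hB) (hS.capacity_le B hB)
    obtain ⟨hXB, hXC⟩ := hc hAB
    -- Passing to the corner loses the crossing with `B` and creates none: an element of `S` is
    -- nested with `B`, so if it crosses `X` it already crosses `A`.
    have hlt : crossNum S X < crossNum S A := by
      refine Set.ncard_lt_ncard (Set.ssubset_iff_of_subset ?_ |>.2 ⟨B, ⟨hB, hAB⟩, fun h => h.2 hXB⟩)
        ((finite_thin_crossing hA.1 n).subset
          fun C hC => ⟨hS.isThin C hC.1, hS.capacity_le C hC.1, hC.2⟩)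
      exact fun C hC => ⟨hC.1, fun h => hC.2 (hXC C h (hS.nested B hB C hC.1))⟩
    have hXmem := ih _ (hk ▸ hlt) X rfl hX hXn
    refine (BooleanSubalgebra.closure_le.2 (Set.union_subset ?_
      (Set.singleton_subset_iff.2 hXmem))) hmem
    rw [← hS.closure_eq]
    exact BooleanSubalgebra.closure_mono Set.subset_union_left

/-- The candidates that are not in the ring generated by lower candidates suffice. -/
theorem mem_closure_minimal (k : ℕ) (A : Set V)
    (hk : crossNum (N.candidates n S) A = k) (hA : A ∈ N.candidates n S) :
      A ∈ BooleanSubalgebra.closure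
        (S ∪ {A ∈ N.candidates n S | A ∉ N.lowerRing n S A}) := by
  induction k using Nat.strong_induction_on generalizing A with
  | _ k ih =>
    by_cases h : A ∈ N.lowerRing n S A
    · refine (BooleanSubalgebra.closure_le.2 (Set.union_subset ?_ ?_)) h
      · exact Set.subset_union_left.trans BooleanSubalgebra.subset_closure
      · exact fun X hX => ih _ (hk ▸ hX.2) X rfl hX.1
    · exact BooleanSubalgebra.subset_closure (Or.inr ⟨hA, h⟩)

/-- A candidate that crosses one corner crosses `A` or `B`; one that crosses both corners crosses
both `A` and `B`. The inequality is strict because `A` crosses `B` but is nested with both corners.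
-/
theorem crossNum_corner_lt (hA : A ∈ N.candidates n S) (hB : B ∈ N.candidates n S)
    (hAB : ¬ NestedCuts A B) :
    crossNum (N.candidates n S) (A ∩ B) + crossNum (N.candidates n S) (Aᶜ ∩ Bᶜ) <
      crossNum (N.candidates n S) A + crossNum (N.candidates n S) B := by
  have hAB' : ¬ NestedCuts Aᶜ Bᶜ := by rwa [nestedCuts_compl_left, nestedCuts_compl_right]
  have hfA := candidates_finite (n := n) (S := S) hA.1.1
  have hfB := candidates_finite (n := n) (S := S) hB.1.1
  unfold crossNum
  rw [← Set.ncard_union_add_ncard_inter _ _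
    (candidates_finite (hA.1.1.inter hB.1.1))
    (candidates_finite (hA.1.compl.1.inter hB.1.compl.1)),
    ← Set.ncard_union_add_ncard_inter _ _ hfA hfB]
  refine add_lt_add_of_lt_of_le (Set.ncard_lt_ncard ?_ (hfA.union hfB))
    (Set.ncard_le_ncard ?_ (hfA.inter_of_left _))
  · refine Set.ssubset_iff_of_subset ?_ |>.2 ⟨A, Or.inr ⟨hA, fun h => hAB h.symm⟩, ?_⟩
    · rintro C (⟨hC, h⟩ | ⟨hC, h⟩)
      · by_contra hcon
        simp only [Set.mem_union, Set.mem_ofPred_eq, not_or, not_and, not_not] at hcon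
        exact h ((hcon.1 hC).inter hAB (hcon.2 hC))
      · by_contra hcon
        simp only [Set.mem_union, Set.mem_ofPred_eq, not_or, not_and, not_not] at hcon
        exact h ((hcon.1 hC).compl_left.inter hAB' (hcon.2 hC).compl_left)
    · rintro (⟨-, h⟩ | ⟨-, h⟩)
      · exact h (nestedCuts_inter_self A B)
      · exact h (nestedCuts_compl_right.1 (nestedCuts_inter_self Aᶜ Bᶜ))
  · rintro C ⟨⟨hC, h1⟩, ⟨-, h2⟩⟩
    refine ⟨⟨hC, fun h => ?_⟩, ⟨hC, fun h => ?_⟩⟩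
    · exact (h.inter_or B).elim h1 h2
    · have := h.inter_or A
      rw [Set.inter_comm B, Set.inter_comm Bᶜ] at this
      exact this.elim h1 h2

/-- If neither corner is in 𝓑ₙ, both have capacity at least n + 1 with sum at most 2n + 2, so both
are candidates. Then `crossNum_corner_lt` makes the first cross fewer candidates than `A` or the
second fewer than `B`. Exchanging `A` and `B` gives the other pairing of corners with cuts. -/
theorem corner_mem_lowerRing (hS : N.IsNestedGenerating n S) (hA : A ∈ N.candidates n S)
    (hB : B ∈ N.candidates n S) (hAB : ¬ NestedCuts A B) :
    (A ∩ B ∈ N.lowerRing n S A ∨ Aᶜ ∩ Bᶜ ∈ N.lowerRing n S B) := by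
  have hring : N.cutRing n ≤ N.lowerRing n S A ⊓ N.lowerRing n S B := by
    rw [← hS.closure_eq]
    exact le_inf (BooleanSubalgebra.closure_mono Set.subset_union_left)
      (BooleanSubalgebra.closure_mono Set.subset_union_left)
  have hcutX := hA.1.1.inter hB.1.1
  have hcutY := hA.1.compl.1.inter hB.1.compl.1
  by_cases hX : A ∩ B ∈ N.cutRing n
  · exact Or.inl (hring hX).1
  by_cases hY : Aᶜ ∩ Bᶜ ∈ N.cutRing n
  · exact Or.inr (hring hY).2
  have h1 := lt_capacity_of_notMem hcutX hX
  have h2 := lt_capacity_of_notMem hcutY hY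
  have h3 := N.capacity_inter_add_le hA.1.1 hB.1.1
  have h4 := hA.2.1
  have h5 := hB.2.1
  have hXt := isThin_of_notMem hcutX hX (by omega)
  have hYt := isThin_of_notMem hcutY hY (by omega)
  have hAB' : ¬ NestedCuts Aᶜ Bᶜ := by rwa [nestedCuts_compl_left, nestedCuts_compl_right]
  have hXc : A ∩ B ∈ N.candidates n S :=
    ⟨hXt.1, hXt.2, fun C hC => (hA.2.2 C hC).inter hAB (hB.2.2 C hC)⟩
  have hYc : Aᶜ ∩ Bᶜ ∈ N.candidates n S :=
    ⟨hYt.1, hYt.2, fun C hC => (hA.2.2 C hC).compl_left.inter hAB' (hB.2.2 C hC).compl_left⟩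
  have hlt := crossNum_corner_lt hA hB hAB
  by_cases h6 : crossNum (N.candidates n S) (A ∩ B) < crossNum (N.candidates n S) A
  · exact Or.inl (BooleanSubalgebra.subset_closure (Or.inr ⟨hXc, h6⟩))
  · exact Or.inr (BooleanSubalgebra.subset_closure (Or.inr ⟨hYc, by omega⟩))

/-- `corner_mem_lowerRing` is used for both pairs of opposite corners and both pairings. Against
this, two corners making up `A` or `Aᶜ` cannot both be in the lower ring of `A`, nor two making up
`B` or `Bᶜ` both in that of `B`. Since the first ring is contained in the second, these constraints
are incompatible. -/
theorem nested_of_crossNum_le (hS : N.IsNestedGenerating n S) (hA : A ∈ N.candidates n S)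
    (hA' : A ∉ N.lowerRing n S A) (hB : B ∈ N.candidates n S) (hB' : B ∉ N.lowerRing n S B)
    (hle : crossNum (N.candidates n S) A ≤ crossNum (N.candidates n S) B) : NestedCuts A B := by
  by_contra hAB
  have hle' := lowerRing_mono hle
  have h1 := corner_mem_lowerRing hS hA hB hAB
  have h2 := corner_mem_lowerRing hS hB hA fun h => hAB h.symm
  have h3 := corner_mem_lowerRing hS hA (candidates_compl hB)
    fun h => hAB (nestedCuts_compl_right.1 h)
  have h4 := corner_mem_lowerRing hS (candidates_compl hB) hA
    fun h => hAB (nestedCuts_compl_right.1 h.symm)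
  rw [compl_compl, lowerRing_compl] at h3 h4
  rw [Set.inter_comm B, Set.inter_comm Bᶜ] at h2
  rw [Set.inter_comm Bᶜ, Set.inter_comm B] at h4
  have hA2 : Aᶜ ∉ N.lowerRing n S A := fun h => hA' (BooleanSubalgebra.compl_mem_iff.1 h)
  have hB2 : Bᶜ ∉ N.lowerRing n S B := fun h => hB' (BooleanSubalgebra.compl_mem_iff.1 h)
  have h5 := inter_mem_or _ B hA'
  have h6 := inter_mem_or _ B hA2
  have h7 := inter_mem_or _ A hB'
  have h8 := inter_mem_or _ A hB2
  rw [Set.inter_comm B, Set.inter_comm B] at h7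
  rw [Set.inter_comm Bᶜ, Set.inter_comm Bᶜ] at h8
  -- In the first case `Aᶜ ∩ B` is forced into the ring of `B`, which already contains `A ∩ B`. In
  -- the second, `Aᶜ ∩ B` is forced into the ring of `A`, and then `A ∩ B` into that of `B`. Either
  -- way `B` is rebuilt.
  rcases h1 with h | h
  · have h9 := h5.resolve_left fun h10 => h10 h
    have h10 := h3.resolve_left h9
    exact h7.elim (fun h11 => h11 (hle' h)) fun h11 => h11 h10
  · have h9 := h8.resolve_right fun h10 => h10 h
    have h10 := h4.resolve_left h9
    have h11 := h2.resolve_right (h6.resolve_left fun h12 => h12 h10)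
    exact h7.elim (fun h12 => h12 h11) fun h12 => h12 (hle' h10)

theorem IsNestedGenerating.succ (hS : N.IsNestedGenerating n S) :
    N.IsNestedGenerating (n + 1) (S ∪ {A ∈ N.candidates n S | A ∉ N.lowerRing n S A}) where
  isThin A hA := hA.elim (hS.isThin A) fun h => h.1.1
  capacity_le A hA := hA.elim (fun h => (hS.capacity_le A h).trans n.le_succ) fun h => h.1.2.1.le
  compl_mem A hA := hA.imp (hS.compl_mem A) fun h => ⟨candidates_compl h.1, fun h1 => h.2 (by
    rw [lowerRing_compl] at h1
    exact BooleanSubalgebra.compl_mem_iff.1 h1)⟩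
  nested := by
    rintro A (hA | hA) B (hB | hB)
    · exact hS.nested A hA B hB
    · exact (hB.1.2.2 A hA).symm
    · exact hA.1.2.2 B hB
    · rcases le_total (crossNum (N.candidates n S) A) (crossNum (N.candidates n S) B) with h | h
      · exact nested_of_crossNum_le hS hA.1 hA.2 hB.1 hB.2 h
      · exact (nested_of_crossNum_le hS hB.1 hB.2 hA.1 hA.2 h).symm
  closure_eq := by
    refine le_antisymm (BooleanSubalgebra.closure_le.2 ?_) (BooleanSubalgebra.closure_le.2 ?_)
    · rintro A (hA | hA)
      · exact mem_cutRing (hS.isThin A hA).1 ((hS.capacity_le A hA).trans n.le_succ)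
      · exact mem_cutRing hA.1.1.1 hA.1.2.1.le
    · rintro A ⟨hA, hAn⟩
      by_cases h : A ∈ N.cutRing n
      · rw [← hS.closure_eq] at h
        exact BooleanSubalgebra.closure_mono Set.subset_union_left h
      · obtain ⟨ht, hcap⟩ := isThin_of_notMem hA h hAn
        refine (BooleanSubalgebra.closure_le.2 (Set.union_subset ?_ ?_))
          (mem_closure_candidates hS _ A rfl ht hcap)
        · exact Set.subset_union_left.trans BooleanSubalgebra.subset_closure
        · exact fun X hX => mem_closure_minimal _ X rfl hX

theorem isNestedGenerating_nestedCutSet (N : Network V) (n : ℕ) :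
    N.IsNestedGenerating n (N.nestedCutSet n) := by
  induction n with
  | zero =>
    refine ⟨fun _ h => h.elim, fun _ h => h.elim, fun _ h => h.elim, fun _ h => h.elim, ?_⟩
    rw [cutRing_zero]
    exact le_bot_iff.1 (BooleanSubalgebra.closure_le.2 fun _ h => h.elim)
  | succ n ih => exact ih.succ

theorem nestedCutSet_mono (N : Network V) : Monotone N.nestedCutSet :=
  monotone_nat_of_le_succ fun _ => Set.subset_union_left

end Network

/-! ### Sides of vertices and ends -/

/-- A single representing ray decides the side, because an edge cut cannot separate equivalent rays.
-/
theorem liesIn_mk_iff {V : Type u} {G : SimpleGraph V} {A : Set V} (hA : IsEdgeCut G A)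
    (R : GraphRay G) :
    LiesIn A (Sum.inr (Quotient.mk (raySetoid G) R) : GraphPoint G) ↔ R.EventuallyIn A := by
  refine ⟨fun h => h R rfl, fun h S hS => ?_⟩
  refine (S.eventuallyIn_or hA).resolve_right fun h' => ?_
  exact Quotient.exact hS ⟨A, hA, Or.inr ⟨h', h⟩⟩

theorem GraphRay.eventuallyIn_compl {V : Type u} {G : SimpleGraph V} {A : Set V}
    (hA : IsEdgeCut G A) (R : GraphRay G) : R.EventuallyIn Aᶜ ↔ ¬ R.EventuallyIn A :=
  ⟨fun h h' => R.not_both h' h, fun h => (R.eventuallyIn_or hA).resolve_left h⟩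

theorem liesIn_compl {V : Type u} {G : SimpleGraph V} {A : Set V} (hA : IsEdgeCut G A)
    (x : GraphPoint G) : LiesIn Aᶜ x ↔ ¬ LiesIn A x := by
  rcases x with v | ω
  · exact Iff.rfl
  · induction ω using Quotient.ind with
    | _ R => rw [liesIn_mk_iff hA.compl, liesIn_mk_iff hA, R.eventuallyIn_compl hA]

theorem liesIn_inter {V : Type u} {G : SimpleGraph V} {A B : Set V} (x : GraphPoint G) :
    LiesIn (A ∩ B) x ↔ LiesIn A x ∧ LiesIn B x := by
  rcases x with v | ω
  · exact Iff.rfl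
  · exact ⟨fun h => ⟨fun R hR => (h R hR).mono fun _ h1 => h1.1,
      fun R hR => (h R hR).mono fun _ h1 => h1.2⟩, fun h R hR => (h.1 R hR).and (h.2 R hR)⟩

theorem LiesIn.mono {V : Type u} {G : SimpleGraph V} {A B : Set V} {x : GraphPoint G}
    (h : LiesIn A x) (hAB : A ⊆ B) : LiesIn B x := by
  rcases x with v | ω
  · exact hAB h
  · exact fun R hR => (h R hR).mono fun _ h1 => hAB h1

theorem not_liesIn_empty {V : Type u} {G : SimpleGraph V} (x : GraphPoint G) :
    ¬ LiesIn ∅ x := by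
  intro h
  have := (liesIn_compl (isEdgeCut_empty G) x).1 (h.mono (Set.empty_subset _))
  exact this h

theorem separates_iff {V : Type u} {G : SimpleGraph V} {A : Set V} (hA : IsEdgeCut G A)
    (x y : GraphPoint G) : Separates A x y ↔ ¬ (LiesIn A x ↔ LiesIn A y) := by
  rw [Separates, liesIn_compl hA, liesIn_compl hA]
  tauto

/-- The ring of the edge cuts that do not separate `x` and `y`. -/
def nonseparatingCuts {V : Type u} {G : SimpleGraph V} (x y : GraphPoint G) :
    BooleanSubalgebra (Set V) where
  carrier := {A | IsEdgeCut G A ∧ (LiesIn A x ↔ LiesIn A y)}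
  infClosed' A hA B hB := ⟨hA.1.inter hB.1, by
    change LiesIn (A ∩ B) x ↔ LiesIn (A ∩ B) y
    rw [liesIn_inter, liesIn_inter, hA.2, hB.2]⟩
  compl_mem' hA := ⟨hA.1.compl, by rw [liesIn_compl hA.1, liesIn_compl hA.1, hA.2]⟩
  bot_mem' := ⟨isEdgeCut_empty G, iff_of_false (not_liesIn_empty x) (not_liesIn_empty y)⟩
  supClosed' A hA B hB := ⟨hA.1.union hB.1, by
    change LiesIn (A ∪ B) x ↔ LiesIn (A ∪ B) y
    have h : A ∪ B = (Aᶜ ∩ Bᶜ)ᶜ := by rw [Set.compl_inter, compl_compl, compl_compl]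
    have h1 := hA.1.compl.inter hB.1.compl
    rw [h, liesIn_compl h1, liesIn_compl h1, liesIn_inter, liesIn_inter, liesIn_compl hA.1,
      liesIn_compl hA.1, liesIn_compl hB.1, liesIn_compl hB.1, hA.2, hB.2]⟩

/-! ### Orientations of a nested set -/

/-- A nested set of proper nonempty sets, closed under complementation, only finitely many of which
separate two given vertices. -/
structure IsTreeSet {V : Type u} (E : Set (Set V)) : Prop where
  nonempty : ∀ A ∈ E, A.Nonempty
  compl_mem : ∀ A ∈ E, Aᶜ ∈ E
  nested : ∀ A ∈ E, ∀ B ∈ E, NestedCuts A B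
  finite_separating : ∀ u v : V, {A ∈ E | u ∈ A ∧ v ∉ A}.Finite

/-- A consistent choice of one of `A`, `Aᶜ` for all `A ∈ E`. -/
structure IsOrientation {V : Type u} (E O : Set (Set V)) : Prop where
  subset : O ⊆ E
  compl_mem_iff : ∀ A ∈ E, Aᶜ ∈ O ↔ A ∉ O
  mem_of_subset : ∀ A ∈ O, ∀ B ∈ E, A ⊆ B → B ∈ O

/-- The sets of `E` that contain `A`, or contain `Aᶜ` properly. -/
def dartSet {V : Type u} (E : Set (Set V)) (A : Set V) : Set (Set V) :=
  {C ∈ E | A ⊆ C ∨ Aᶜ ⊂ C}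

/-- The vertices of the structure tree: the orientations that differ from the orientation towards
a vertex in finitely many places. -/
def IsNode {V : Type u} (E O : Set (Set V)) : Prop :=
  IsOrientation E O ∧ ∀ v : V, (O \ {A | v ∈ A}).Finite

/-- The type of the vertices of the structure tree. -/
abbrev TreeNode {V : Type u} (E : Set (Set V)) : Type u := {O : Set (Set V) // IsNode E O}

section Orientations

variable {V : Type u} {E O P : Set (Set V)} {A B C : Set V}

theorem IsTreeSet.compl_nonempty (hE : IsTreeSet E) (hA : A ∈ E) : Aᶜ.Nonempty :=
  hE.nonempty _ (hE.compl_mem A hA)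

theorem IsOrientation.compl_notMem (hO : IsOrientation E O) (hA : A ∈ O) : Aᶜ ∉ O :=
  fun h => (hO.compl_mem_iff A (hO.subset hA)).1 h hA

theorem IsOrientation.compl_mem (hO : IsOrientation E O) (hA : A ∈ E) (h : A ∉ O) : Aᶜ ∈ O :=
  (hO.compl_mem_iff A hA).2 h

theorem IsOrientation.eq_of_subset (hO : IsOrientation E O) (hP : IsOrientation E P)
    (h : O ⊆ P) : O = P :=
  h.antisymm fun _ hA => by_contra fun h1 =>
    hP.compl_notMem hA (h (hO.compl_mem (hP.subset hA) h1))

theorem isOrientation_liesIn {G : SimpleGraph V} (hE : IsTreeSet E)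
    (hcut : ∀ A ∈ E, IsEdgeCut G A) (x : GraphPoint G) :
    IsOrientation E {A ∈ E | LiesIn A x} where
  subset _ hA := hA.1
  compl_mem_iff A hA := by
    have h1 : Aᶜ ∈ {A ∈ E | LiesIn A x} ↔ LiesIn Aᶜ x := and_iff_right (hE.compl_mem A hA)
    have h2 : A ∈ {A ∈ E | LiesIn A x} ↔ LiesIn A x := and_iff_right hA
    rw [h1, h2, liesIn_compl (hcut A hA)]
  mem_of_subset _ hA B hB hAB := ⟨hB, hA.2.mono hAB⟩

theorem isNode_vertex (hE : IsTreeSet E) (v : V) : IsNode E {A ∈ E | v ∈ A} := by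
  refine ⟨⟨fun _ hA => hA.1, fun A hA => ?_, fun A hA B hB hAB => ⟨hB, hAB hA.2⟩⟩, fun w => ?_⟩
  · have h1 : Aᶜ ∈ {A ∈ E | v ∈ A} ↔ v ∈ Aᶜ := and_iff_right (hE.compl_mem A hA)
    have h2 : A ∈ {A ∈ E | v ∈ A} ↔ v ∈ A := and_iff_right hA
    rw [h1, h2, Set.mem_compl_iff]
  · exact (hE.finite_separating v w).subset fun A hA => ⟨hA.1.1, hA.1.2, hA.2⟩

/-- Each of the four inclusions expressing that `A` and `C` are nested selects `C` or `Cᶜ`;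
strictness in `Aᶜ ⊂ C` excludes `Aᶜ` itself. Every selected set contains a fixed point of `A` or a
fixed point of `Aᶜ`, so only finitely many of them miss a given vertex. -/
theorem IsTreeSet.isNode_dartSet (hE : IsTreeSet E) (hA : A ∈ E) : IsNode E (dartSet E A) := by
  have hne := hE.nonempty A hA
  have hne' := hE.compl_nonempty hA
  refine ⟨⟨fun _ h => h.1, fun C hC => ⟨?_, fun h => ⟨hE.compl_mem C hC, ?_⟩⟩, ?_⟩, fun v => ?_⟩
  · rintro ⟨-, h | h⟩ ⟨-, h' | h'⟩
    · obtain ⟨a, ha⟩ := hne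
      exact h ha (h' ha)
    · exact h'.2 (Set.subset_compl_comm.1 h)
    · have := Set.compl_subset_compl.1 h.1
      exact h.2 (Set.compl_subset_compl.2 h')
    · obtain ⟨a, ha⟩ := hne'
      exact h.1 ha (h'.1 ha)
  · have h1 : ¬ (A ⊆ C ∨ Aᶜ ⊂ C) := fun h1 => h ⟨hC, h1⟩
    rcases nestedCuts_iff.1 (hE.nested A hA C hC) with h2 | h2 | h2 | h2
    · exact Or.inl h2
    · exact Or.inr ⟨Set.compl_subset_compl.2 h2,
        fun h3 => h1 (Or.inl (Set.compl_subset_compl.1 h3))⟩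
    · exact absurd (Or.inl h2) h1
    · by_cases h3 : C ⊆ Aᶜ
      · exact Or.inl (Set.subset_compl_comm.1 h3)
      · exact absurd (Or.inr ⟨h2, h3⟩) h1
  · rintro C ⟨-, h | h⟩ B hB hCB
    · exact ⟨hB, Or.inl (h.trans hCB)⟩
    · exact ⟨hB, Or.inr (h.trans_subset hCB)⟩
  · obtain ⟨a, ha⟩ := hne
    obtain ⟨b, hb⟩ := hne'
    refine ((hE.finite_separating a v).union (hE.finite_separating b v)).subset ?_
    rintro C ⟨⟨hC, h | h⟩, hv⟩
    · exact Or.inl ⟨hC, h ha, hv⟩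
    · exact Or.inr ⟨hC, h.1 hb, hv⟩

theorem mem_dartSet_self (hA : A ∈ E) : A ∈ dartSet E A := ⟨hA, Or.inl subset_rfl⟩

/-- Away from `A` and `Aᶜ` the strictness is immaterial and the definition is symmetric: the two
ends of a tree edge differ only in the orientation of that edge. -/
theorem mem_dartSet_compl_iff (h : C ≠ A) (h' : C ≠ Aᶜ) :
    C ∈ dartSet E Aᶜ ↔ C ∈ dartSet E A := by
  simp only [dartSet, Set.mem_ofPred_eq, compl_compl, Set.ssubset_iff_subset_ne, ne_eq, h.symm,
    h'.symm, not_false_eq_true, and_true]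
  tauto

theorem IsTreeSet.notMem_dartSet_compl (hE : IsTreeSet E) (hA : A ∈ E) :
    A ∉ dartSet E Aᶜ := fun h =>
  (hE.isNode_dartSet (hE.compl_mem A hA)).1.compl_notMem h (mem_dartSet_self (hE.compl_mem A hA))

theorem eq_of_mem_dartSet (hB : B ∈ dartSet E A)
    (hB' : B ∉ dartSet E Aᶜ) : B = A := by
  by_contra h
  by_cases h' : B = Aᶜ
  · subst h'
    exact hB' (mem_dartSet_self hB.1)
  · exact hB' ((mem_dartSet_compl_iff h h').2 hB)

/-- If `Aᶜ ⊂ C` and `C` were not chosen, then `Cᶜ` would be a chosen proper subset of `A`, against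
minimality. -/
theorem IsOrientation.eq_dartSet (hE : IsTreeSet E) (hO : IsOrientation E O) (hA : A ∈ O)
    (hmin : ∀ C ∈ O, C ⊆ A → C = A) : O = dartSet E A := by
  refine ((hE.isNode_dartSet (hO.subset hA)).1.eq_of_subset hO ?_).symm
  rintro C ⟨hC, h | h⟩
  · exact hO.mem_of_subset A hA C hC h
  · by_contra h1
    have h2 := hmin _ (hO.compl_mem hC h1) (Set.compl_subset_comm.1 h.1)
    exact h.2 (by rw [← h2, compl_compl])

/-- Crossing the edge of `A` towards `O` removes exactly `A` from the difference with `O`, which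
therefore measures the remaining distance. -/
theorem dartSet_compl_diff (hE : IsTreeSet E) (hO : IsOrientation E O) (hA : A ∈ E)
    (h : A ∉ O) : dartSet E Aᶜ \ O = (dartSet E A \ O) \ {A} := by
  have hA' := hO.compl_mem hA h
  ext C
  constructor
  · rintro ⟨h1, h2⟩
    have h3 : C ≠ A := fun h3 => hE.notMem_dartSet_compl hA (h3 ▸ h1)
    have h4 : C ≠ Aᶜ := fun h4 => h2 (h4 ▸ hA')
    exact ⟨⟨(mem_dartSet_compl_iff h3 h4).1 h1, h2⟩, h3⟩
  · rintro ⟨⟨h1, h2⟩, h3⟩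
    have h4 : C ≠ Aᶜ := fun h4 => h2 (h4 ▸ hA')
    exact ⟨(mem_dartSet_compl_iff h3 h4).2 h1, h2⟩

/-- If a node differs from an orientation, then it can be moved towards it. -/
theorem IsNode.exists_step (hE : IsTreeSet E) (hP : IsNode E P) (hO : IsOrientation E O)
    (hne : P ≠ O) : ∃ A ∈ E, A ∈ P ∧ A ∉ O ∧ P = dartSet E A := by
  obtain ⟨B, hBP, hBO⟩ : ∃ B ∈ P, B ∉ O := by
    by_contra h
    push Not at h
    exact hne (hP.1.eq_of_subset hO h)
  obtain ⟨v, hv⟩ := hE.compl_nonempty (hP.1.subset hBP)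
  -- Members of `P` inside `B` miss the vertex `v`, so the finiteness condition on nodes provides a
  -- minimal one. It is not in `O`, since otherwise the larger set `B` would be.
  have hfin : {C ∈ P | C ⊆ B}.Finite :=
    (hP.2 v).subset fun C hC => ⟨hC.1, fun h => hv (hC.2 h)⟩
  obtain ⟨A, hA⟩ := hfin.exists_minimal ⟨B, hBP, subset_rfl⟩
  refine ⟨A, hP.1.subset hA.1.1, hA.1.1,
    fun h => hBO (hO.mem_of_subset A h B (hP.1.subset hBP) hA.1.2),
    hP.1.eq_dartSet hE hA.1.1 fun C hC hCA => ?_⟩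
  exact hCA.antisymm (hA.2 ⟨hC, hCA.trans hA.1.2⟩ hCA)

theorem IsNode.diff_finite [Nonempty V] (hP : IsNode E P) (hO : IsNode E O) :
    (P \ O).Finite := by
  obtain ⟨v⟩ := ‹Nonempty V›
  refine ((hP.2 v).union ((hO.2 v).image compl)).subset ?_
  rintro A ⟨h1, h2⟩
  by_cases hv : v ∈ A
  · exact Or.inr ⟨Aᶜ, ⟨hO.1.compl_mem (hP.1.subset h1) h2, fun h => h hv⟩, compl_compl A⟩
  · exact Or.inl ⟨h1, hv⟩

end Orientations

/-! ### The structure tree of a nested set -/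

namespace IsTreeSet

variable {V : Type u} {E O : Set (Set V)} (hE : IsTreeSet E)

/-- The initial vertex of the oriented edge that corresponds to `A`. -/
def node (A : E) : TreeNode E := ⟨dartSet E A, hE.isNode_dartSet A.2⟩

/-- The complement, as an element of the tree set. -/
def star (A : E) : E := ⟨(A : Set V)ᶜ, hE.compl_mem A A.2⟩

theorem star_star (A : E) : hE.star (hE.star A) = A := Subtype.ext (compl_compl _)

theorem node_ne (A : E) : hE.node A ≠ hE.node (hE.star A) := fun h =>
  hE.notMem_dartSet_compl A.2 ((congrArg Subtype.val h).le (mem_dartSet_self A.2))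

/-- The structure tree. -/
def graph : SimpleGraph (TreeNode E) where
  Adj P Q := ∃ A : E, P = hE.node A ∧ Q = hE.node (hE.star A)
  symm := ⟨fun P Q ⟨A, hP, hQ⟩ => ⟨hE.star A, hQ, by rw [star_star]; exact hP⟩⟩
  loopless := ⟨fun P ⟨A, hP, hQ⟩ => hE.node_ne A (hP.symm.trans hQ)⟩

theorem adj_node (A : E) : hE.graph.Adj (hE.node A) (hE.node (hE.star A)) := ⟨A, rfl, rfl⟩

/-- The oriented edge that corresponds to `A`. -/
def dart (A : E) : hE.graph.Dart := ⟨(hE.node A, hE.node (hE.star A)), hE.adj_node A⟩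

theorem eq_of_mem_node {A B : E} (h : (B : Set V) ∈ (hE.node A).1)
    (h' : (B : Set V) ∉ (hE.node (hE.star A)).1) : B = A :=
  Subtype.ext (eq_of_mem_dartSet h h')

theorem mem_node_self (A : E) : (A : Set V) ∈ (hE.node A).1 := mem_dartSet_self A.2

theorem notMem_node_star (A : E) : (A : Set V) ∉ (hE.node (hE.star A)).1 :=
  hE.notMem_dartSet_compl A.2

theorem eq_of_node_eq {A B : E} (h : hE.node A = hE.node B)
    (h' : hE.node (hE.star A) = hE.node (hE.star B)) : A = B :=
  hE.eq_of_mem_node (h ▸ hE.mem_node_self A) (h' ▸ hE.notMem_node_star A)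

theorem dart_bijective : Function.Bijective hE.dart := by
  constructor
  · intro A B h
    exact hE.eq_of_node_eq (congrArg (fun d => d.fst) h) (congrArg (fun d => d.snd) h)
  · rintro ⟨⟨P, Q⟩, A, hP, hQ⟩
    refine ⟨A, ?_⟩
    dsimp only at hP hQ
    subst hP
    subst hQ
    rfl

/-- The correspondence between oriented edges and elements of `E`. -/
noncomputable def edgeCut : hE.graph.Dart ≃ E := (Equiv.ofBijective _ hE.dart_bijective).symm

theorem edgeCut_dart (A : E) : hE.edgeCut (hE.dart A) = A :=
  (Equiv.ofBijective _ hE.dart_bijective).symm_apply_apply A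

theorem dart_symm (A : E) : (hE.dart A).symm = hE.dart (hE.star A) := by
  have h : (hE.dart (hE.star A)).toProd = (hE.node (hE.star A), hE.node A) :=
    congrArg (fun B => (hE.node (hE.star A), hE.node B)) (hE.star_star A)
  exact SimpleGraph.Dart.ext _ _ h.symm

theorem exists_step (P : TreeNode E) (hO : IsOrientation E O) (hne : P.1 ≠ O) :
    ∃ A : E, P = hE.node A ∧ (A : Set V) ∈ P.1 ∧ (A : Set V) ∉ O := by
  obtain ⟨A, hA, hAP, hAO, hP⟩ := P.2.exists_step hE hO hne
  exact ⟨⟨A, hA⟩, Subtype.ext hP, hAP, hAO⟩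

theorem star_diff (hO : IsOrientation E O) {A : E} (hA : (A : Set V) ∉ O) :
    (hE.node (hE.star A)).1 \ O = ((hE.node A).1 \ O) \ {(A : Set V)} :=
  dartSet_compl_diff hE hO A.2 hA

/-- A set of nodes that is not left by an edge between `P` and `Q` contains both or none. -/
theorem mem_iff_of_geodesic [Nonempty V] (K : Set (TreeNode E)) (P Q : TreeNode E)
    (h : ∀ A : E, (A : Set V) ∈ P.1 → (A : Set V) ∉ Q.1 →
      (hE.node A ∈ K ↔ hE.node (hE.star A) ∈ K)) : P ∈ K ↔ Q ∈ K := by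
  -- This number is the distance from `P` to `Q`; a step over `A` removes only `A` from the
  -- difference, so the hypothesis persists.
  obtain ⟨k, hk⟩ : ∃ k, (P.1 \ Q.1).ncard = k := ⟨_, rfl⟩
  induction k generalizing P with
  | zero =>
    rw [Set.ncard_eq_zero (P.2.diff_finite Q.2), Set.sdiff_eq_empty] at hk
    rw [Subtype.ext (P.2.1.eq_of_subset Q.2.1 hk)]
  | succ k ih =>
    have hne : P.1 ≠ Q.1 := by
      intro h1
      rw [h1, Set.sdiff_self, Set.ncard_empty] at hk
      omega
    obtain ⟨A, rfl, hAP, hAQ⟩ := hE.exists_step P Q.2.1 hne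
    rw [h A hAP hAQ]
    have hd := hE.star_diff Q.2.1 hAQ
    refine ih _ (fun B hB hB' => h B ?_ hB') ?_
    · exact (hd.le ⟨hB, hB'⟩).1.1
    · have hmem : (A : Set V) ∈ (hE.node A).1 \ Q.1 := ⟨hAP, hAQ⟩
      rw [hd, Set.ncard_sdiff_singleton_of_mem hmem, hk]
      rfl

theorem connected [Nonempty V] : hE.graph.Connected := by
  obtain ⟨v⟩ := id ‹Nonempty V›
  have : Nonempty (TreeNode E) := ⟨⟨_, isNode_vertex hE v⟩⟩
  refine SimpleGraph.Connected.mk fun P Q => ?_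
  refine (hE.mem_iff_of_geodesic {R | hE.graph.Reachable P R} P Q fun A _ _ => ?_).1
    (SimpleGraph.Reachable.refl P)
  exact ⟨fun h => SimpleGraph.Reachable.trans h (hE.adj_node A).reachable,
    fun h => SimpleGraph.Reachable.trans h (hE.adj_node A).symm.reachable⟩

/-- The nodes on the side of `A`. -/
def sideSet (_ : IsTreeSet E) (A : Set V) : Set (TreeNode E) := {P | A ∈ P.1}

theorem sideSet_compl (A : E) : hE.sideSet (A : Set V)ᶜ = (hE.sideSet A)ᶜ :=
  Set.ext fun P => P.2.1.compl_mem_iff A A.2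

theorem mem_edgeBoundary_sideSet {A : E} {P Q : TreeNode E} (h : hE.graph.Adj P Q)
    (hP : (A : Set V) ∈ P.1) (hQ : (A : Set V) ∉ Q.1) :
    P = hE.node A ∧ Q = hE.node (hE.star A) := by
  obtain ⟨B, rfl, rfl⟩ := h
  obtain rfl := hE.eq_of_mem_node hP hQ
  exact ⟨rfl, rfl⟩

theorem isEdgeCut_sideSet (A : E) : IsEdgeCut hE.graph (hE.sideSet A) := by
  refine (Set.finite_singleton (⟨s(hE.node A, hE.node (hE.star A)), hE.adj_node A⟩ :
    hE.graph.edgeSet)).subset ?_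
  rintro ⟨e, he⟩ ⟨P, Q, hP, hQ, h⟩
  dsimp only at h
  subst h
  obtain ⟨rfl, rfl⟩ := hE.mem_edgeBoundary_sideSet he hP hQ
  rfl

theorem eq_or_eq_star {A B : E}
    (h : s(hE.node A, hE.node (hE.star A)) = s(hE.node B, hE.node (hE.star B))) :
    A = B ∨ A = hE.star B := by
  rcases Sym2.eq_iff.1 h with ⟨h1, h2⟩ | ⟨h1, h2⟩
  · exact Or.inl (hE.eq_of_node_eq h1 h2)
  · exact Or.inr (hE.eq_of_node_eq h1 (by rw [star_star]; exact h2))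

/-- The edge of `A` is the only one leaving `sideSet A`. Conversely, a path moving from `node A` to
a node containing `A` crosses only edges on whose orientation these nodes differ, hence never that
of `A`. -/
theorem initialSide_dart [Nonempty V] (A : E) :
    initialSide hE.graph (hE.dart A) = hE.sideSet A := by
  ext R
  constructor
  · intro h
    by_contra hR
    obtain ⟨P, Q, hP, hQ, hadj⟩ :=
      exists_adj_of_reachable (A := hE.sideSet A) h (hE.mem_node_self A) hR
    rw [SimpleGraph.deleteEdges_adj] at hadj
    obtain ⟨rfl, rfl⟩ := hE.mem_edgeBoundary_sideSet hadj.1 hP hQ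
    exact hadj.2 rfl
  · intro hR
    refine (hE.mem_iff_of_geodesic (initialSide hE.graph (hE.dart A)) (hE.node A) R
      fun B hB hBR => ?_).1 (SimpleGraph.Reachable.refl _)
    have hadj : (hE.graph.deleteEdges {(hE.dart A).edge}).Adj (hE.node B)
        (hE.node (hE.star B)) := by
      rw [SimpleGraph.deleteEdges_adj]
      refine ⟨hE.adj_node B, fun h => ?_⟩
      rcases hE.eq_or_eq_star h with rfl | rfl
      · exact hBR hR
      · exact hE.notMem_node_star (hE.star A) (by rw [star_star]; exact hB)
    exact ⟨fun h => SimpleGraph.Reachable.trans h hadj.reachable,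
      fun h => SimpleGraph.Reachable.trans h hadj.symm.reachable⟩

theorem isTree [Nonempty V] : hE.graph.IsTree := by
  refine ⟨hE.connected, SimpleGraph.isAcyclic_iff_forall_adj_isBridge.2 ?_⟩
  rintro P Q ⟨A, rfl, rfl⟩
  rw [SimpleGraph.isBridge_iff]
  intro h
  exact hE.notMem_node_star A ((hE.initialSide_dart A).le h)

/-! ### Ends of the structure tree -/

/-- An arbitrary cut of the tree has finitely many boundary edges. Far enough out, the two rays
agree on the orientation of each, so the path between their vertices crosses none of them. An end of
the tree is thus determined by the orientation it induces. -/
theorem rays_equiv [Nonempty V] (R S : GraphRay hE.graph)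
    (h : ∀ A : E, R.EventuallyIn (hE.sideSet A) → S.EventuallyIn (hE.sideSet A)) :
    Quotient.mk (raySetoid hE.graph) R = Quotient.mk (raySetoid hE.graph) S := by
  have key : ∀ K : Set (TreeNode E), IsEdgeCut hE.graph K → R.EventuallyIn K →
      S.EventuallyIn Kᶜ → False := by
    intro K hK hR hS
    obtain ⟨f, hf⟩ := exists_bijective_outEdges hE.graph K
    have hfin : (outEdges hE.graph K).Finite := by
      have := Set.Finite.to_subtype hK
      exact Set.finite_coe_iff.1 (Finite.of_injective f hf.1)
    have hD : {A : E | (hE.node A, hE.node (hE.star A)) ∈ outEdges hE.graph K}.Finite := by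
      refine Set.Finite.preimage (Function.Injective.injOn fun A B hAB => ?_) hfin
      exact hE.eq_of_node_eq (congrArg Prod.fst hAB) (congrArg Prod.snd hAB)
    have hev : ∀ᶠ i in atTop, ∀ A ∈ {A : E | (hE.node A, hE.node (hE.star A)) ∈
        outEdges hE.graph K}, ((A : Set V) ∈ (R.vert i).1 ↔ (A : Set V) ∈ (S.vert i).1) := by
      refine (eventually_all_finite hD).2 fun A _ => ?_
      rcases R.eventuallyIn_or (hE.isEdgeCut_sideSet A) with h1 | h1
      · filter_upwards [h1, h A h1] with i h2 h3
        exact iff_of_true h2 h3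
      · have h1' : R.EventuallyIn (hE.sideSet (hE.star A : E)) := by
          rw [← sideSet_compl] at h1
          exact h1
        have h2 := h _ h1'
        change S.EventuallyIn (hE.sideSet (A : Set V)ᶜ) at h2
        rw [sideSet_compl] at h2
        filter_upwards [h1, h2] with i h3 h4
        exact iff_of_false h3 h4
    obtain ⟨i, hi, hiR, hiS⟩ := (hev.and (hR.and hS)).exists
    refine hiS ((hE.mem_iff_of_geodesic K (R.vert i) (S.vert i) fun A hAR hAS => ?_).1 hiR)
    by_contra hcon
    by_cases hA : hE.node A ∈ K
    · have hA' : hE.node (hE.star A) ∉ K := fun h2 => hcon (iff_of_true hA h2)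
      exact hAS ((hi A ⟨hA, hA', hE.adj_node A⟩).1 hAR)
    · have hA' : hE.node (hE.star A) ∈ K := by_contra fun h2 => hcon (iff_of_false hA h2)
      have hmem : (hE.node (hE.star A), hE.node (hE.star (hE.star A))) ∈ outEdges hE.graph K := by
        rw [star_star]
        exact ⟨hA', hA, (hE.adj_node A).symm⟩
      have h2 := hi (hE.star A) hmem
      exact (S.vert i).2.1.compl_mem A.2 hAS |> h2.2 |> (R.vert i).2.1.compl_notMem hAR
  refine Quotient.sound ?_
  rintro ⟨K, hK, ⟨h1, h2⟩ | ⟨h1, h2⟩⟩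
  · exact key K hK h1 h2
  · exact key Kᶜ hK.compl h1 (by rwa [compl_compl])

/-- Starting from any node, step towards `O` forever; each step removes the crossed set from the
difference with `O`, so sets and nodes never repeat. If some `A ∈ O` were never reached, all crossed
sets would lie in `Aᶜ` and belong to the initial node: infinitely many of its members would miss a
point of `A`. -/
theorem exists_ray [Nonempty V] (hO : IsOrientation E O) (hO' : ¬ IsNode E O) :
    ∃ R : GraphRay hE.graph, ∀ A ∈ O, R.EventuallyIn (hE.sideSet A) := by
  have hne : ∀ P : TreeNode E, P.1 ≠ O := fun P h => hO' (h ▸ P.2)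
  choose g hg hgP hgO using fun P : TreeNode E => hE.exists_step P hO (hne P)
  obtain ⟨v⟩ := id ‹Nonempty V›
  let f : ℕ → TreeNode E := fun k =>
    Nat.rec ⟨_, isNode_vertex hE v⟩ (fun _ P => hE.node (hE.star (g P))) k
  have hf : ∀ k, f (k + 1) = hE.node (hE.star (g (f k))) := fun k => rfl
  have hd : ∀ k, (f (k + 1)).1 \ O = ((f k).1 \ O) \ {(g (f k) : Set V)} := by
    intro k
    rw [hf, hE.star_diff hO (hgO (f k)), ← hg (f k)]
  have hanti : Antitone fun k => (f k).1 \ O :=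
    antitone_nat_of_succ_le fun k => by
      change (f (k + 1)).1 \ O ⊆ (f k).1 \ O
      rw [hd]
      exact Set.sdiff_subset
  have hnot : ∀ i j, i < j → (g (f i) : Set V) ∉ (f j).1 \ O := fun i j hij h =>
    ((hd i).le (hanti (Nat.succ_le_of_lt hij) h)).2 rfl
  have hself : ∀ i, (g (f i) : Set V) ∈ (f i).1 \ O := fun i => ⟨hgP _, hgO _⟩
  have hginj : Function.Injective fun i => (g (f i) : Set V) := by
    intro i j hij
    dsimp only at hij
    by_contra hne'
    rcases Nat.lt_or_gt_of_ne hne' with h | h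
    · exact hnot i j h (hij ▸ hself j)
    · exact hnot j i h (hij ▸ hself i)
  have hfinj : Function.Injective f := fun i j hij =>
    hginj (by change (g (f i) : Set V) = g (f j); rw [hij])
  refine ⟨⟨f, hfinj, fun i => ⟨g (f i), hg _, hf i⟩⟩, fun A hA => ?_⟩
  have hAE := hO.subset hA
  have hcompl : Aᶜ ∉ O := hO.compl_notMem hA
  suffices h : ∃ k, A ∈ (f k).1 by
    obtain ⟨k, hk⟩ := h
    refine eventually_atTop.2 ⟨k, fun j hj => ?_⟩
    by_contra hAj
    have h1 : Aᶜ ∈ (f k).1 \ O := hanti hj ⟨(f j).2.1.compl_mem hAE hAj, hcompl⟩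
    exact (f k).2.1.compl_notMem hk h1.1
  by_contra hcon
  push Not at hcon
  have hAk : ∀ k, Aᶜ ∈ (f k).1 := fun k => (f k).2.1.compl_mem hAE (hcon k)
  obtain ⟨w, hw⟩ := hE.nonempty A hAE
  -- The current node contains `Aᶜ`, so the crossed set or its complement lies in `Aᶜ`; the
  -- complement is in `O` and would force `Aᶜ ∈ O`.
  have hsub : ∀ k, (g (f k) : Set V) ⊆ Aᶜ := by
    intro k
    have h1 : Aᶜ ∈ (hE.node (g (f k))).1 := hg (f k) ▸ hAk k
    rcases h1.2 with h | h
    · exact h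
    · exact absurd (hO.mem_of_subset _ (hO.compl_mem (g (f k)).2 (hgO _)) _
        (hE.compl_mem A hAE) h.1) hcompl
  refine Set.infinite_of_injective_forall_mem hginj (fun k => ?_) ((f 0).2.2 w)
  exact ⟨(hanti (Nat.zero_le k) (hself k)).1, fun h => hsub k h hw⟩

end IsTreeSet

/-! ### The point of the tree determined by an orientation -/

namespace IsTreeSet

variable {V : Type u} {E O : Set (Set V)} (hE : IsTreeSet E)

open Classical in
/-- The vertex or end of the structure tree that an orientation points to. -/
noncomputable def point [Nonempty V] (hO : IsOrientation E O) : GraphPoint hE.graph :=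
  if h : IsNode E O then Sum.inl ⟨O, h⟩
  else Sum.inr (Quotient.mk _ (hE.exists_ray hO h).choose)

theorem liesIn_point [Nonempty V] (hO : IsOrientation E O) (A : E) :
    LiesIn (hE.sideSet A) (hE.point hO) ↔ (A : Set V) ∈ O := by
  by_cases h : IsNode E O
  · rw [point, dif_pos h]
    exact Iff.rfl
  · rw [point, dif_neg h, liesIn_mk_iff (hE.isEdgeCut_sideSet A)]
    have hs := (hE.exists_ray hO h).choose_spec
    refine ⟨fun h1 => by_contra fun h2 => ?_, hs A⟩
    have h3 := hs _ (hO.compl_mem A.2 h2)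
    rw [sideSet_compl] at h3
    exact GraphRay.not_both _ h1 h3

theorem exists_dart (e : hE.graph.edgeSet) :
    ∃ A : E, (e : Sym2 (TreeNode E)) = s(hE.node A, hE.node (hE.star A)) := by
  obtain ⟨e, he⟩ := e
  induction e using Sym2.ind with
  | _ P Q =>
    obtain ⟨A, rfl, rfl⟩ : hE.graph.Adj P Q := he
    exact ⟨A, rfl⟩

end IsTreeSet

/-! ### The tree network and the map ν -/

namespace Network

variable {V : Type u} {E : Set (Set V)}

theorem nonempty_vertices (N : Network V) : Nonempty V := N.connected.nonempty

variable (N : Network V)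

/-- The capacities of the edges of the structure tree. -/
noncomputable def treeCap (hE : IsTreeSet E) (hcut : ∀ A ∈ E, IsEdgeCut N.graph A)
    (e : hE.graph.edgeSet) : ℕ+ :=
  let A := (hE.exists_dart e).choose
  ⟨N.capacity A, N.capacity_pos (hcut A A.2) (hE.nonempty A A.2) (hE.compl_nonempty A.2)⟩

/-- The set chosen for an edge is determined up to complement, and complements have equal capacity.
-/
theorem treeCap_eq (hE : IsTreeSet E) (hcut : ∀ A ∈ E, IsEdgeCut N.graph A)
    (e : hE.graph.edgeSet) (A : E)
    (h : (e : Sym2 (TreeNode E)) = s(hE.node A, hE.node (hE.star A))) :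
    (N.treeCap hE hcut e : ℕ) = N.capacity A := by
  have h1 := (hE.exists_dart e).choose_spec
  change N.capacity (hE.exists_dart e).choose = N.capacity A
  rcases hE.eq_or_eq_star (h1.symm.trans h) with h2 | h2
  · rw [h2]
  · rw [h2]
    exact N.capacity_compl A

/-- The tree network of a nested set of cuts. -/
noncomputable def treeNetwork (hE : IsTreeSet E) (hcut : ∀ A ∈ E, IsEdgeCut N.graph A) :
    Network (TreeNode E) where
  graph := hE.graph
  connected :=
    have := N.nonempty_vertices
    hE.connected
  cap := N.treeCap hE hcut

/-- The structure tree of a nested set of cuts. -/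
noncomputable def structureTree (hE : IsTreeSet E) (hcut : ∀ A ∈ E, IsEdgeCut N.graph A) :
    StructureTree N E :=
  have : Nonempty V := N.nonempty_vertices
  { VT := TreeNode E
    net := N.treeNetwork hE hcut
    isTree := hE.isTree
    edgeCut := hE.edgeCut
    edgeCut_symm := fun d => by
      obtain ⟨A, rfl⟩ := hE.dart_bijective.2 d
      change (hE.edgeCut (hE.dart A).symm : Set V) = (hE.edgeCut (hE.dart A) : Set V)ᶜ
      rw [hE.dart_symm, hE.edgeCut_dart, hE.edgeCut_dart]
      rfl
    cap_eq := fun d => by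
      obtain ⟨A, rfl⟩ := hE.dart_bijective.2 d
      exact (N.treeCap_eq hE hcut _ A rfl).trans
        (congrArg (fun B : E => N.capacity B) (hE.edgeCut_dart A).symm)
    ν := fun x => hE.point (isOrientation_liesIn hE hcut x)
    ν_vertex := fun v => ⟨⟨_, isNode_vertex hE v⟩, dif_pos (isNode_vertex hE v)⟩
    side := fun d x => by
      obtain ⟨A, rfl⟩ := hE.dart_bijective.2 d
      change (LiesIn (hE.edgeCut (hE.dart A) : Set V) x →
          LiesIn (initialSide hE.graph (hE.dart A)) (hE.point _)) ∧
        (LiesIn (hE.edgeCut (hE.dart A) : Set V)ᶜ x →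
          LiesIn (initialSide hE.graph (hE.dart A))ᶜ (hE.point _))
      rw [hE.edgeCut_dart, hE.initialSide_dart, liesIn_compl (hE.isEdgeCut_sideSet A),
        hE.liesIn_point, liesIn_compl (hcut A A.2)]
      exact ⟨fun h => ⟨A.2, h⟩, fun h h1 => h h1.2⟩ }

theorem ν_eq_iff (hE : IsTreeSet E) (hcut : ∀ A ∈ E, IsEdgeCut N.graph A)
    (x y : GraphPoint N.graph) :
    (N.structureTree hE hcut).ν x = (N.structureTree hE hcut).ν y ↔
      ∀ A ∈ E, (LiesIn A x ↔ LiesIn A y) := by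
  have := N.nonempty_vertices
  change hE.point (isOrientation_liesIn hE hcut x) = hE.point (isOrientation_liesIn hE hcut y) ↔ _
  constructor
  · intro h A hA
    have h1 := hE.liesIn_point (isOrientation_liesIn hE hcut x) ⟨A, hA⟩
    rw [h, hE.liesIn_point] at h1
    exact ⟨fun h2 => (h1.2 ⟨hA, h2⟩).2, fun h2 => (h1.1 ⟨hA, h2⟩).2⟩
  · intro h
    have h1 : {A ∈ E | LiesIn A x} = {A ∈ E | LiesIn A y} :=
      Set.ext fun A => and_congr_right fun hA => h A hA
    congr 1

theorem IsNestedGenerating.isTreeSet {N : Network V} {n : ℕ} (hE : N.IsNestedGenerating n E) :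
    IsTreeSet E where
  nonempty A hA := (hE.isThin A hA).nonempty
  compl_mem := hE.compl_mem
  nested := hE.nested
  finite_separating u v := (N.finite_thin_separating n u v).subset fun A hA =>
    ⟨hE.isThin A hA.1, hE.capacity_le A hA.1, hA.2.1, hA.2.2⟩

/-- The cuts that do not separate `x` and `y` form a ring; once it contains the generators `E` it
contains all of 𝓑ₙ. -/
theorem IsNestedGenerating.ν_eq_iff {N : Network V} {n : ℕ} (hE : N.IsNestedGenerating n E)
    (hT : IsTreeSet E) (hcut : ∀ A ∈ E, IsEdgeCut N.graph A) (x y : GraphPoint N.graph) :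
    (N.structureTree hT hcut).ν x = (N.structureTree hT hcut).ν y ↔
      ¬ ∃ A, N.IsCutLE n A ∧ Separates A x y := by
  rw [N.ν_eq_iff]
  constructor
  · rintro h ⟨A, hA, hsep⟩
    have hle : BooleanSubalgebra.closure E ≤ nonseparatingCuts x y :=
      BooleanSubalgebra.closure_le.2 fun B hB => ⟨hcut B hB, h B hB⟩
    rw [hE.closure_eq] at hle
    exact (separates_iff hA.1 x y).1 hsep (hle (mem_cutRing hA.1 hA.2)).2
  · intro h A hA
    by_contra hcon
    exact h ⟨A, ⟨hcut A hA, hE.capacity_le A hA⟩, (separates_iff (hcut A hA) x y).2 hcon⟩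

end Network

/-! ### Transport along isomorphisms -/

theorem preimage_mem_closure {V W : Type u} (f : V → W) {S : Set (Set V)} {T : Set (Set W)}
    (h : ∀ B ∈ T, f ⁻¹' B ∈ BooleanSubalgebra.closure S) {A : Set W}
    (hA : A ∈ BooleanSubalgebra.closure T) : f ⁻¹' A ∈ BooleanSubalgebra.closure S := by
  let L : BooleanSubalgebra (Set W) :=
    { carrier := {A | f ⁻¹' A ∈ BooleanSubalgebra.closure S}
      supClosed' := fun _ hA _ hB => (BooleanSubalgebra.closure S).supClosed hA hB
      infClosed' := fun _ hA _ hB => (BooleanSubalgebra.closure S).infClosed hA hB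
      compl_mem' := fun hA => (BooleanSubalgebra.closure S).compl_mem' hA
      bot_mem' := (BooleanSubalgebra.closure S).bot_mem' }
  have hL : BooleanSubalgebra.closure T ≤ L := BooleanSubalgebra.closure_le.2 h
  exact hL hA

theorem preimage_mem_closure_iff {V W : Type u} (e : V ≃ W) {S : Set (Set V)} {A : Set W} :
    e ⁻¹' A ∈ BooleanSubalgebra.closure S ↔
      A ∈ BooleanSubalgebra.closure {B : Set W | e ⁻¹' B ∈ S} := by
  refine ⟨fun h => ?_, preimage_mem_closure e fun B hB => BooleanSubalgebra.subset_closure hB⟩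
  have := preimage_mem_closure e.symm (T := S) (S := {B : Set W | e ⁻¹' B ∈ S})
    (fun B hB => BooleanSubalgebra.subset_closure (by
      change e ⁻¹' (e.symm ⁻¹' B) ∈ S
      rwa [e.preimage_symm_preimage])) h
  rwa [e.symm_preimage_preimage] at this

theorem nestedCuts_preimage_iff {V W : Type u} (e : V ≃ W) {A B : Set W} :
    NestedCuts (e ⁻¹' A) (e ⁻¹' B) ↔ NestedCuts A B := by
  simp only [nestedCuts_iff, ← Set.preimage_compl, e.surjective.preimage_subset_preimage_iff]

namespace Network

variable {V W : Type u} {N : Network V} {M : Network W} (φ : N.Iso M) {n : ℕ}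
  {S : Set (Set V)} {A : Set W}

/-- The underlying bijection of an isomorphism of networks. -/
abbrev Iso.equiv (φ : N.Iso M) : V ≃ W := φ.toIso.toEquiv

theorem isEdgeCut_preimage_iff : IsEdgeCut N.graph (φ.equiv ⁻¹' A) ↔ IsEdgeCut M.graph A := by
  refine ⟨fun h => ?_, fun h => h.preimage φ.toIso⟩
  have : IsEdgeCut M.graph (φ.equiv.symm ⁻¹' (φ.equiv ⁻¹' A)) := h.preimage φ.toIso.symm
  rwa [φ.equiv.symm_preimage_preimage] at this

theorem capacity_preimage : N.capacity (φ.equiv ⁻¹' A) = M.capacity A := by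
  have hmem : ∀ e, e ∈ edgeBoundary N.graph (φ.equiv ⁻¹' A) ↔
      φ.toIso.mapEdgeSet e ∈ edgeBoundary M.graph A := by
    refine edgeSet_cases fun u v huv => ?_
    rw [mem_edgeBoundary_mk]
    exact (mem_edgeBoundary_mk (φ.toIso.map_adj_iff.2 huv)).symm
  refine finsum_mem_eq_of_bijOn φ.toIso.mapEdgeSet ⟨fun e he => (hmem e).1 he,
    φ.toIso.mapEdgeSet.injective.injOn, fun e he => ?_⟩ fun e _ => by rw [φ.cap_eq]
  obtain ⟨e, rfl⟩ := φ.toIso.mapEdgeSet.surjective e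
  exact ⟨e, (hmem e).2 he, rfl⟩

theorem isThin_preimage_iff : N.IsThin (φ.equiv ⁻¹' A) ↔ M.IsThin A := by
  rw [IsThin, IsThin, isEdgeCut_preimage_iff, preimage_mem_closure_iff]
  simp only [Set.mem_ofPred_eq, isEdgeCut_preimage_iff, capacity_preimage]

theorem forall_preimage_iff (e : V ≃ W) {p : Set V → Prop} :
    (∀ B : Set V, p B) ↔ ∀ B : Set W, p (e ⁻¹' B) :=
  ⟨fun h _ => h _, fun h B => e.preimage_symm_preimage B ▸ h (e.symm ⁻¹' B)⟩

theorem preimage_mem_candidates_iff : φ.equiv ⁻¹' A ∈ N.candidates n S ↔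
    A ∈ M.candidates n {B | φ.equiv ⁻¹' B ∈ S} := by
  change N.IsThin _ ∧ N.capacity _ = n + 1 ∧ (∀ B : Set V, B ∈ S → NestedCuts _ B) ↔
    M.IsThin A ∧ M.capacity A = n + 1 ∧ ∀ B : Set W, φ.equiv ⁻¹' B ∈ S → NestedCuts A B
  rw [isThin_preimage_iff, capacity_preimage, forall_preimage_iff φ.equiv]
  simp only [nestedCuts_preimage_iff]

theorem crossNum_preimage (e : V ≃ W) :
    crossNum S (e ⁻¹' A) = crossNum {B | e ⁻¹' B ∈ S} A := by
  have h : {B ∈ S | ¬ NestedCuts (e ⁻¹' A) B} =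
      Set.preimage e '' {B ∈ {B | e ⁻¹' B ∈ S} | ¬ NestedCuts A B} := by
    ext B
    constructor
    · intro hB
      refine ⟨e.symm ⁻¹' B, ⟨?_, ?_⟩, e.preimage_symm_preimage B⟩
      · change e ⁻¹' (e.symm ⁻¹' B) ∈ S
        rw [e.preimage_symm_preimage]
        exact hB.1
      · rw [← nestedCuts_preimage_iff e, e.preimage_symm_preimage]
        exact hB.2
    · rintro ⟨C, hC, rfl⟩
      exact ⟨hC.1, fun h => hC.2 ((nestedCuts_preimage_iff e).1 h)⟩
  rw [crossNum, h, Set.ncard_image_of_injective _ e.surjective.preimage_injective, crossNum]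

theorem preimage_mem_lowerRing_iff : φ.equiv ⁻¹' A ∈ N.lowerRing n S (φ.equiv ⁻¹' A) ↔
    A ∈ M.lowerRing n {B | φ.equiv ⁻¹' B ∈ S} A := by
  rw [lowerRing, lowerRing, preimage_mem_closure_iff]
  have hc : {B | φ.equiv ⁻¹' B ∈ N.candidates n S} =
      M.candidates n {B | φ.equiv ⁻¹' B ∈ S} :=
    Set.ext fun B => preimage_mem_candidates_iff φ
  have h : {B | φ.equiv ⁻¹' B ∈ S ∪ {X ∈ N.candidates n S |
      crossNum (N.candidates n S) X < crossNum (N.candidates n S) (φ.equiv ⁻¹' A)}} =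
      {B | φ.equiv ⁻¹' B ∈ S} ∪ {X ∈ M.candidates n {B | φ.equiv ⁻¹' B ∈ S} |
        crossNum (M.candidates n {B | φ.equiv ⁻¹' B ∈ S}) X <
          crossNum (M.candidates n {B | φ.equiv ⁻¹' B ∈ S}) A} := by
    ext B
    change (_ ∨ (_ ∧ _ < _)) ↔ (_ ∨ (_ ∧ _ < _))
    rw [crossNum_preimage, crossNum_preimage, hc, preimage_mem_candidates_iff]
    rfl
  rw [h]

/-- No choice enters the recursion: thinness, capacity, nestedness, crossing numbers and generated
rings are all transported by the isomorphism. -/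
theorem preimage_mem_nestedCutSet_iff :
    φ.equiv ⁻¹' A ∈ N.nestedCutSet n ↔ A ∈ M.nestedCutSet n := by
  induction n generalizing A with
  | zero => exact Iff.rfl
  | succ n ih =>
    have hS : {B | φ.equiv ⁻¹' B ∈ N.nestedCutSet n} = M.nestedCutSet n := Set.ext fun B => ih
    change (_ ∨ (_ ∧ ¬ _)) ↔ (_ ∨ (_ ∧ ¬ _))
    rw [ih, preimage_mem_candidates_iff, preimage_mem_lowerRing_iff, hS]

end Network

/-! ### Isomorphisms of structure trees -/

section Push

variable {V W : Type u} (e : V ≃ W) {E O : Set (Set V)} {E' : Set (Set W)}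

/-- The image of a family of sets under a bijection. -/
def pushFamily (O : Set (Set V)) : Set (Set W) := {B | e ⁻¹' B ∈ O}

theorem pushFamily_symm (O : Set (Set V)) : pushFamily e.symm (pushFamily e O) = O :=
  Set.ext fun A => by
    change e ⁻¹' (e.symm ⁻¹' A) ∈ O ↔ A ∈ O
    rw [e.preimage_symm_preimage]

theorem IsOrientation.push (hO : IsOrientation E O) :
    IsOrientation (pushFamily e E) (pushFamily e O) where
  subset _ hB := hO.subset hB
  compl_mem_iff B hB := hO.compl_mem_iff (e ⁻¹' B) hB
  mem_of_subset _ hA B hB hAB := hO.mem_of_subset _ hA (e ⁻¹' B) hB (Set.preimage_mono hAB)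

theorem IsNode.push (hO : IsNode E O) : IsNode (pushFamily e E) (pushFamily e O) := by
  refine ⟨hO.1.push e, fun w => ?_⟩
  refine ((hO.2 (e.symm w)).preimage (f := Set.preimage e)
    e.surjective.preimage_injective.injOn).subset fun B hB => ⟨hB.1, fun h => hB.2 ?_⟩
  have h' : e (e.symm w) ∈ B := h
  rwa [e.apply_symm_apply] at h'

theorem isNode_push_iff : IsNode (pushFamily e E) (pushFamily e O) ↔ IsNode E O := by
  refine ⟨fun h => ?_, IsNode.push e⟩
  have := h.push e.symm
  rwa [pushFamily_symm, pushFamily_symm] at this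

theorem pushFamily_dartSet (B : Set W) :
    pushFamily e (dartSet E (e ⁻¹' B)) = dartSet (pushFamily e E) B := by
  ext C
  change (_ ∧ (e ⁻¹' B ⊆ e ⁻¹' C ∨ (e ⁻¹' B)ᶜ ⊂ e ⁻¹' C)) ↔ (_ ∧ (B ⊆ C ∨ Bᶜ ⊂ C))
  rw [← Set.preimage_compl, Set.ssubset_def, Set.ssubset_def]
  simp only [e.surjective.preimage_subset_preimage_iff]
  rfl

/-- The action of a bijection on the nodes of structure trees. -/
def TreeNode.equiv (h : pushFamily e E = E') : TreeNode E ≃ TreeNode E' where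
  toFun P := ⟨pushFamily e P.1, h ▸ P.2.push e⟩
  invFun P := ⟨pushFamily e.symm P.1, by
    subst h
    have := P.2.push e.symm
    rwa [pushFamily_symm] at this⟩
  left_inv P := Subtype.ext (pushFamily_symm e P.1)
  right_inv P := Subtype.ext (pushFamily_symm e.symm P.1)

/-- The element of `E` that corresponds to an element of `E'`. -/
def pullElement (h : pushFamily e E = E') (B : E') : E := ⟨e ⁻¹' B, h.ge B.2⟩

theorem pullElement_surjective (h : pushFamily e E = E') :
    Function.Surjective (pullElement e h) := by
  intro A
  refine ⟨⟨e.symm ⁻¹' A, h.le ?_⟩, Subtype.ext (e.preimage_symm_preimage A)⟩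
  change e ⁻¹' (e.symm ⁻¹' A) ∈ E
  rw [e.preimage_symm_preimage]
  exact A.2

variable (hE : IsTreeSet E) (hE' : IsTreeSet E') (h : pushFamily e E = E')

theorem equiv_node (B : E') :
    TreeNode.equiv e h (hE.node (pullElement e h B)) = hE'.node B := by
  subst h
  exact Subtype.ext (pushFamily_dartSet e B)

theorem equiv_node_star (B : E') :
    TreeNode.equiv e h (hE.node (hE.star (pullElement e h B))) = hE'.node (hE'.star B) :=
  equiv_node e hE hE' h (hE'.star B)

/-- The isomorphism of structure trees induced by a bijection that maps `E` onto `E'`. -/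
def treeIso : hE.graph ≃g hE'.graph where
  toEquiv := TreeNode.equiv e h
  map_rel_iff' := by
    intro P Q
    constructor
    · rintro ⟨B, hP, hQ⟩
      rw [← equiv_node e hE hE' h] at hP
      rw [← equiv_node_star e hE hE' h] at hQ
      exact ⟨pullElement e h B, (TreeNode.equiv e h).injective hP,
        (TreeNode.equiv e h).injective hQ⟩
    · rintro ⟨A, rfl, rfl⟩
      obtain ⟨B, rfl⟩ := pullElement_surjective e h A
      exact ⟨B, equiv_node e hE hE' h B, equiv_node_star e hE hE' h B⟩

/-- The rays on the two sides are chosen independently and need not correspond. Their ends do,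
because both rays follow the same orientation and `rays_equiv` applies. -/
theorem map_point [Nonempty V] [Nonempty W] (hO : IsOrientation E O) {O' : Set (Set W)}
    (hO' : IsOrientation E' O') (hOO' : pushFamily e O = O') :
    hE'.point hO' = GraphPoint.map (treeIso e hE hE' h) (hE.point hO) := by
  subst h
  subst hOO'
  by_cases hn : IsNode E O
  · rw [IsTreeSet.point, IsTreeSet.point, dif_pos hn, dif_pos (hn.push e)]
    rfl
  · have hn' : ¬ IsNode (pushFamily e E) (pushFamily e O) := fun h1 =>
      hn ((isNode_push_iff e).1 h1)
    rw [IsTreeSet.point, IsTreeSet.point, dif_neg hn, dif_neg hn']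
    refine congrArg Sum.inr ?_
    refine hE'.rays_equiv _ (GraphRay.map (treeIso e hE hE' rfl) _) fun B hB => ?_
    have h1 : (B : Set W) ∈ pushFamily e O := by
      rw [← hE'.liesIn_point (hO.push e) B, IsTreeSet.point, dif_neg hn',
        liesIn_mk_iff (hE'.isEdgeCut_sideSet B)]
      exact hB
    exact (hE.exists_ray hO hn).choose_spec _ h1

end Push

/-! ### The canonical structure trees of a network -/

namespace Network

theorem Iso.ext' {V W : Type u} {N : Network V} {M : Network W} {φ ψ : N.Iso M}
    (h : ∀ v, φ.toIso v = ψ.toIso v) : φ = ψ := by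
  obtain ⟨φ, hφ⟩ := φ
  obtain ⟨ψ, hψ⟩ := ψ
  obtain rfl : φ = ψ := RelIso.ext h
  rfl

theorem isTreeSet_nestedCutSet {V : Type u} (N : Network V) (n : ℕ) :
    IsTreeSet (N.nestedCutSet n) :=
  (N.isNestedGenerating_nestedCutSet n).isTreeSet

theorem isEdgeCut_of_mem_nestedCutSet {V : Type u} (N : Network V) (n : ℕ) :
    ∀ A ∈ N.nestedCutSet n, IsEdgeCut N.graph A :=
  fun A hA => ((N.isNestedGenerating_nestedCutSet n).isThin A hA).1

/-- The canonical structure tree. -/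
noncomputable def canonicalTree {V : Type u} (N : Network V) (n : ℕ) :
    StructureTree N (N.nestedCutSet n) :=
  N.structureTree (N.isTreeSet_nestedCutSet n) (N.isEdgeCut_of_mem_nestedCutSet n)

variable {V W : Type u} {N : Network V} {M : Network W}

theorem pushFamily_nestedCutSet (φ : N.Iso M) (n : ℕ) :
    pushFamily φ.equiv (N.nestedCutSet n) = M.nestedCutSet n :=
  Set.ext fun _ => preimage_mem_nestedCutSet_iff φ

/-- The isomorphism of canonical structure trees that is induced by an isomorphism of networks. -/
noncomputable def canonicalIso (φ : N.Iso M) (n : ℕ) :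
    (N.canonicalTree n).net.Iso (M.canonicalTree n).net where
  toIso := treeIso φ.equiv (N.isTreeSet_nestedCutSet n) (M.isTreeSet_nestedCutSet n)
    (pushFamily_nestedCutSet φ n)
  cap_eq e := by
    have h := pushFamily_nestedCutSet φ n
    have hN := N.isTreeSet_nestedCutSet n
    have hM := M.isTreeSet_nestedCutSet n
    obtain ⟨A, hA⟩ := hN.exists_dart e
    obtain ⟨B, rfl⟩ := pullElement_surjective φ.equiv h A
    refine PNat.coe_injective ?_
    refine (M.treeCap_eq hM (M.isEdgeCut_of_mem_nestedCutSet n) _ B ?_).trans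
      (Eq.trans ?_ (N.treeCap_eq hN (N.isEdgeCut_of_mem_nestedCutSet n) e _ hA).symm)
    · change Sym2.map (TreeNode.equiv φ.equiv h) e.1 = _
      rw [hA, Sym2.map_mk, equiv_node φ.equiv hN hM h, equiv_node_star φ.equiv hN hM h]
    · exact (capacity_preimage φ).symm

theorem edgeCut_canonicalIso (φ : N.Iso M) (n : ℕ) (d : (N.canonicalTree n).net.graph.Dart) :
    ((M.canonicalTree n).edgeCut ((canonicalIso φ n).toIso.toHom.mapDart d) : Set W) =
      φ.toIso '' ((N.canonicalTree n).edgeCut d : Set V) := by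
  have h := pushFamily_nestedCutSet φ n
  have hN := N.isTreeSet_nestedCutSet n
  have hM := M.isTreeSet_nestedCutSet n
  obtain ⟨A, rfl⟩ := hN.dart_bijective.2 d
  obtain ⟨B, rfl⟩ := pullElement_surjective φ.equiv h A
  have hd : (canonicalIso φ n).toIso.toHom.mapDart (hN.dart (pullElement φ.equiv h B)) =
      hM.dart B :=
    SimpleGraph.Dart.ext _ _ (Prod.ext (equiv_node φ.equiv hN hM h B)
      (equiv_node_star φ.equiv hN hM h B))
  rw [hd]
  change ((hM.edgeCut (hM.dart B) : M.nestedCutSet n) : Set W) =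
    φ.equiv '' ((hN.edgeCut (hN.dart (pullElement φ.equiv h B)) : N.nestedCutSet n) : Set V)
  rw [hM.edgeCut_dart, hN.edgeCut_dart]
  exact (Set.image_preimage_eq _ φ.equiv.surjective).symm

theorem liesIn_map_iff (φ : N.Iso M) {B : Set W} (hB : IsEdgeCut M.graph B)
    (x : GraphPoint N.graph) :
    LiesIn B (GraphPoint.map φ.toIso x) ↔ LiesIn (φ.equiv ⁻¹' B) x := by
  rcases x with v | ω
  · exact Iff.rfl
  · induction ω using Quotient.ind with
    | _ R =>
      exact (liesIn_mk_iff hB (R.map φ.toIso)).trans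
        (liesIn_mk_iff (hB.preimage φ.toIso) R).symm

theorem ν_canonicalIso (φ : N.Iso M) (n : ℕ) (x : GraphPoint N.graph) :
    (M.canonicalTree n).ν (GraphPoint.map φ.toIso x) =
      GraphPoint.map (canonicalIso φ n).toIso ((N.canonicalTree n).ν x) := by
  have := N.nonempty_vertices
  have := M.nonempty_vertices
  have hN := N.isTreeSet_nestedCutSet n
  have hM := M.isTreeSet_nestedCutSet n
  refine map_point φ.equiv hN hM (pushFamily_nestedCutSet φ n)
    (isOrientation_liesIn hN (N.isEdgeCut_of_mem_nestedCutSet n) x)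
    (isOrientation_liesIn hM (M.isEdgeCut_of_mem_nestedCutSet n) _) (Set.ext fun B => ?_)
  change (φ.equiv ⁻¹' B ∈ _ ∧ _) ↔ (B ∈ _ ∧ _)
  rw [preimage_mem_nestedCutSet_iff]
  exact and_congr_right fun hB =>
    (liesIn_map_iff φ (M.isEdgeCut_of_mem_nestedCutSet n B hB) x).symm

end Network

theorem theorem3 :
    -- simultaneously for all networks `N` and all `n`: a set of cuts, a tree network with a map
    -- `ν`, and, for every isomorphism of networks, an isomorphism of the tree networks
    ∃ (E : ∀ {V : Type u}, Network V → ℕ → Set (Set V))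
      (T : ∀ {V : Type u} (N : Network V) (n : ℕ), StructureTree N (E N n))
      (F : ∀ {V W : Type u} {N : Network V} {M : Network W},
        N.Iso M → ∀ n : ℕ, (T N n).net.Iso (T M n).net),
      -- `E N n` is a nested set of thin cuts of capacity at most `n`, closed under complements,
      -- that generates the ring of the cuts of capacity at most `n`
      (∀ (V : Type u) (N : Network V) (n : ℕ),
        (∀ A ∈ E N n, N.IsCutLE n A ∧ N.IsThin A) ∧
        (∀ A ∈ E N n, Aᶜ ∈ E N n) ∧
        (∀ A ∈ E N n, ∀ B ∈ E N n, NestedCuts A B) ∧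
        BooleanSubalgebra.closure (E N n) = N.cutRing n) ∧
      (∀ (V : Type u) (N : Network V) (m n : ℕ), m ≤ n → E N m ⊆ E N n) ∧
      -- `ν` identifies exactly those vertices and ends that no cut of capacity `≤ n` separates
      (∀ (V : Type u) (N : Network V) (n : ℕ) (x y : GraphPoint N.graph),
        (T N n).ν x = (T N n).ν y ↔ ¬ ∃ A, N.IsCutLE n A ∧ Separates A x y) ∧
      -- everything is invariant under isomorphisms, in particular under automorphisms, of networks
      (∀ (V W : Type u) (N : Network V) (M : Network W) (φ : N.Iso M) (n : ℕ),
        (∀ A : Set V, A ∈ E N n ↔ φ.toIso '' A ∈ E M n) ∧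
        (∀ d : (T N n).net.graph.Dart,
          ((T M n).edgeCut ((F φ n).toIso.toHom.mapDart d) : Set W) =
            φ.toIso '' ((T N n).edgeCut d : Set V)) ∧
        (∀ x : GraphPoint N.graph,
          (T M n).ν (GraphPoint.map φ.toIso x) = GraphPoint.map (F φ n).toIso ((T N n).ν x))) ∧
      (∀ (V : Type u) (N : Network V) (n : ℕ),
        F (Network.Iso.refl N) n = Network.Iso.refl (T N n).net) ∧
      (∀ (V W U : Type u) (N : Network V) (M : Network W) (L : Network U)
        (φ : N.Iso M) (ψ : M.Iso L) (n : ℕ), F (φ.trans ψ) n = (F φ n).trans (F ψ n)) := by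
  refine ⟨fun N n => N.nestedCutSet n, fun N n => N.canonicalTree n,
    fun φ n => Network.canonicalIso φ n, fun V N n => ?_, fun V N m n h => N.nestedCutSet_mono h,
    fun V N n x y => (N.isNestedGenerating_nestedCutSet n).ν_eq_iff _ _ x y,
    fun V W N M φ n => ⟨fun A => ?_, Network.edgeCut_canonicalIso φ n,
      Network.ν_canonicalIso φ n⟩, fun V N n => ?_, fun V W U N M L φ ψ n => ?_⟩
  · have h := N.isNestedGenerating_nestedCutSet n
    exact ⟨fun A hA => ⟨⟨(h.isThin A hA).1, h.capacity_le A hA⟩, h.isThin A hA⟩, h.compl_mem,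
      h.nested, h.closure_eq⟩
  · rw [← Network.preimage_mem_nestedCutSet_iff φ]
    have h : φ.equiv ⁻¹' (φ.toIso '' A) = A := Set.preimage_image_eq A φ.equiv.injective
    rw [h]
  -- Nodes are moved by taking preimages of sets, for which identity and composition laws hold
  -- definitionally.
  · exact Network.Iso.ext' fun _ => rfl
  · exact Network.Iso.ext' fun _ => rfl
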